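/- Let $\ell$ be a prime, $E_\lambda$ a finite extension of $\mathbb Q_\ell$ with ring of integers $\mathfrak o_\lambda$ and maximal ideal $\mathfrak m_\lambda$, and let $A=\mathfrak o_\lambda/\mathfrak m_\lambda^n$ for some $n\ge 1$. Let $\pi:Y\to X$ be a finite étale Galois covering of schemes on which $\ell$ is invertible, with finite group $G$; that is, $\pi$ is finite, étale and surjective, $G$ acts on $Y$ by $X$-automorphisms, and the morphism $\coprod_{\sigma\in G}Y\to Y\times_XY$ given by $y\mapsto(y,\sigma y)$ on the copy indexed by $\sigma$ is an isomorphism. An étale sheaf of free $A$-modules is a sheaf of $A$-modules on the small étale site all of whose stalks at geometric points are free $A$-modules. It is called constructible if every affine open subscheme has a finite decomposition into constructible locally closed subschemes, on each of which the sheaf is locally constant with finitely generated values. Let $\mathcal C_{X,Y}$ be the following category. Its objects are the étale sheaves $\mathcal F$ of free $A$-modules on $Y$ together with isomorphisms $\Psi_\sigma:\mathcal F\to\sigma^*\mathcal F$ for every $\sigma\in G$ such that $$(\tau^*\Psi_\sigma)\circ\Psi_\tau=\Phi_{\sigma,\tau}\circ\Psi_{\sigma\tau}:\mathcal F\to\tau^*\sigma^*\mathcal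 F\qquad\text{for all }\sigma,\tau\in G,$$ where $\Phi_{\sigma,\tau}:(\sigma\tau)^*\mathcal F\to\tau^*\sigma^*\mathcal F$ is the natural isomorphism. A morphism $(\mathcal F,\{\Psi_\sigma\})\to(\mathcal F',\{\Psi'_\sigma\})$ is a morphism of sheaves of $A$-modules $\rho:\mathcal F\to\mathcal F'$ such that $\Psi'_\sigma\circ\rho=(\sigma^*\rho)\circ\Psi_\sigma$ for every $\sigma\in G$. Let $\mathcal C^{c}_{X,Y}\subseteq\mathcal C_{X,Y}$ be the full subcategory of the objects with $\mathcal F$ constructible. Then the functor $$F:\mathcal G\mapsto\bigl(\pi^*\mathcal G,\ \{\pi^*\mathcal G=(\pi\sigma)^*\mathcal G\cong\sigma^*\pi^*\mathcal G\}_{\sigma\in G}\bigr),\qquad \rho\mapsto\pi^*\rho,$$ is well defined and is an equivalence from the category of étale sheaves of free $A$-modules on $X$ to $\mathcal C_{X,Y}$. It restricts to an equivalence from the category of constructible étale sheaves of free $A$-modules on $X$ to $\mathcal C^{c}_{X,Y}$. -/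

import Mathlib

open CategoryTheory Limits AlgebraicGeometry Opposite
universe u
noncomputable section
namespace EtaleDescent

/-- Étale morphisms, as a property of morphisms of schemes. -/
abbrev etaleProp : MorphismProperty Scheme.{u} := fun _ _ f => Etale f
instance : (etaleProp.{u}).IsStableUnderBaseChange := Etale.etale_isStableUnderBaseChange

/-- The base change functor `U ↦ U ×_Y X` between the small étale sites. -/
def siteFunctor {X Y : Scheme.{u}} (f : X ⟶ Y) : Y.Etale ⥤ X.Etale :=
  MorphismProperty.Over.pullback etaleProp.{u} ⊤ f

instance {X Y : Scheme.{u}} (f : X ⟶ Y) : PreservesFiniteLimits (siteFunctor f) :=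
  inferInstanceAs <| PreservesFiniteLimits (MorphismProperty.Over.pullback etaleProp.{u} ⊤ f)
instance {X Y : Scheme.{u}} (f : X ⟶ Y) : RepresentablyFlat (siteFunctor f) :=
  flat_of_preservesFiniteLimits _

lemma siteFunctor_coverPreserving {X Y : Scheme.{u}} (f : X ⟶ Y) :
    CoverPreserving Y.smallEtaleTopology X.smallEtaleTopology (siteFunctor f) where
  cover_preserve {U S} hS := by
    obtain ⟨ι, V, g, rfl⟩ := S.exists_eq_ofArrows
    rw [Sieve.ofArrows, ← Sieve.generate_map_eq_functorPushforward, Presieve.map_ofArrows]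
    have h := (Scheme.ofArrows_mem_smallEtaleTopology_iff g).1 hS
    refine (Scheme.ofArrows_mem_smallEtaleTopology_iff _).2 ?_
    refine Set.eq_univ_of_forall fun (x : (pullback U.hom f : Scheme)) => ?_
    have hx : (pullback.fst U.hom f) x ∈ ⋃ i, Set.range (g i).left := by rw [h]; trivial
    obtain ⟨i, v, hv⟩ := Set.mem_iUnion.1 hx
    have sq : IsPullback (pullback.fst (V i).hom f) ((siteFunctor f).map (g i)).left
        (g i).left (pullback.fst U.hom f) := by
      have h1 : IsPullback (pullback.fst U.hom f) (pullback.snd U.hom f) U.hom f :=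
        IsPullback.of_hasPullback _ _
      have h2 : IsPullback (pullback.fst (V i).hom f) (pullback.snd (V i).hom f) (V i).hom f :=
        IsPullback.of_hasPullback _ _
      have e1 : ((siteFunctor f).map (g i)).left ≫ pullback.snd U.hom f =
        pullback.snd (V i).hom f := pullback.lift_snd _ _ _
      have e2 : ((siteFunctor f).map (g i)).left ≫ pullback.fst U.hom f =
        pullback.fst (V i).hom f ≫ (g i).left := pullback.lift_fst _ _ _
      refine (IsPullback.of_right ?_ e2 h1.flip).flip
      rw [e1, show (g i).left ≫ U.hom = (V i).hom from Over.w _]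
      exact h2.flip
    obtain ⟨w, -, hw⟩ := Scheme.Pullback.exists_preimage_pullback v x hv
    refine Set.mem_iUnion.2 ⟨i, sq.isoPullback.inv w, ?_⟩
    rw [← hw]
    exact congr_arg (fun k : pullback (g i).left (pullback.fst U.hom f) ⟶ _ => k w)
      sq.isoPullback_inv_snd

instance {X Y : Scheme.{u}} (f : X ⟶ Y) :
    (siteFunctor f).IsContinuous Y.smallEtaleTopology X.smallEtaleTopology :=
  Functor.isContinuous_iff_coverPreserving.2 (siteFunctor_coverPreserving f)

/-- Sheaves of `A`-modules on the small étale site of `X`. -/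
abbrev EtaleSheaf (A : Type u) [CommRing A] (X : Scheme.{u}) :=
  Sheaf X.smallEtaleTopology (ModuleCat.{u} A)

variable (A : Type u) [CommRing A]

/-- The direct image `f_*`, given by `(f_* F)(U) = F(U ×_Y X)`. -/
abbrev directImage {X Y : Scheme.{u}} (f : X ⟶ Y) : EtaleSheaf A X ⥤ EtaleSheaf A Y :=
  (siteFunctor f).sheafPushforwardContinuous (ModuleCat.{u} A) _ _

instance directImage_isRightAdjoint {X Y : Scheme.{u}} (f : X ⟶ Y) : (directImage A f).IsRightAdjoint := by
  let G := Scheme.AffineEtale.Spec Y ⋙ siteFunctor f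
  have : G.IsContinuous (Scheme.AffineEtale.topology Y) X.smallEtaleTopology :=
    Functor.isContinuous_comp _ _ _ Y.smallEtaleTopology _
  let R := (Scheme.AffineEtale.Spec Y).sheafPushforwardContinuous (ModuleCat.{u} A)
      (Scheme.AffineEtale.topology Y) Y.smallEtaleTopology
  have : ∀ (F : Y.AffineEtaleᵒᵖ ⥤ ModuleCat.{u} A), G.op.HasLeftKanExtension F := by
    intro F
    have : G.op.HasPointwiseLeftKanExtension F := by
      intro d
      have : EssentiallySmall.{u} (CostructuredArrow G.op d) := inferInstance
      have := hasColimitsOfShape_of_essentiallySmall.{u} (CostructuredArrow G.op d) (ModuleCat.{u} A)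
      unfold Functor.HasPointwiseLeftKanExtensionAt
      infer_instance
    infer_instance
  have h : (G.sheafPushforwardContinuous (ModuleCat.{u} A) (Scheme.AffineEtale.topology Y)
      X.smallEtaleTopology).IsRightAdjoint := inferInstance
  have h2 : (directImage A f ⋙ R).IsRightAdjoint := h
  have e : directImage A f ≅ (directImage A f ⋙ R) ⋙ R.inv :=
    (Functor.rightUnitor _).symm ≪≫ Functor.isoWhiskerLeft _ R.asEquivalence.unitIso ≪≫ (Functor.associator _ _ _).symm
  exact Functor.isRightAdjoint_of_iso e.symm

/-- The inverse image `f^*`, the left adjoint of the direct image `f_*`. -/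
abbrev inverseImage {X Y : Scheme.{u}} (f : X ⟶ Y) : EtaleSheaf A Y ⥤ EtaleSheaf A X :=
  (siteFunctor f).sheafPullback (ModuleCat.{u} A) _ _

/-- The isomorphism `(U ×_Z Y) ×_Y X ≅ U ×_Z X`, where `h = g ∘ f`. -/
def siteFunctorComp {X Y Z : Scheme.{u}} (f : X ⟶ Y) (g : Y ⟶ Z) (h : X ⟶ Z) (w : f ≫ g = h) :
    siteFunctor g ⋙ siteFunctor f ≅ siteFunctor h :=
  (MorphismProperty.Over.pullbackComp (P := etaleProp.{u}) (Q := ⊤) f g h w.symm).symm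

/-- The first projection `U ×_Y X ⟶ U`. -/
abbrev siteFst {X Y : Scheme.{u}} (f : X ⟶ Y) (U : Y.Etale) : ((siteFunctor f).obj U).left ⟶ U.left :=
  pullback.fst U.hom f

lemma site_hom_ext {X Y : Scheme.{u}} (f : X ⟶ Y) {U : Y.Etale} {V : X.Etale}
    {a b : V ⟶ (siteFunctor f).obj U} (h : a.left ≫ siteFst f U = b.left ≫ siteFst f U) : a = b := by
  apply MorphismProperty.Over.Hom.ext
  apply pullback.hom_ext h
  exact (MorphismProperty.Over.w a).trans (MorphismProperty.Over.w b).symm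

lemma siteFunctor_map_fst {X Y : Scheme.{u}} (f : X ⟶ Y) {U V : Y.Etale} (a : U ⟶ V) :
   ((siteFunctor f).map a).left ≫ siteFst f V = siteFst f U ≫ a.left := pullback.lift_fst _ _ _

lemma siteFunctorComp_fst {X Y Z : Scheme.{u}} (f : X ⟶ Y) (g : Y ⟶ Z) (h : X ⟶ Z) (w : f ≫ g = h)
    (U : Z.Etale) : ((siteFunctorComp f g h w).hom.app U).left ≫ siteFst h U =
      siteFst f ((siteFunctor g).obj U) ≫ siteFst g U := by
  subst w
  have := MorphismProperty.Over.pullbackComp_left_fst_fst (P := etaleProp.{u}) (Q := ⊤) f g U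
  have h2 : ((siteFunctorComp f g _ rfl).hom.app U).left ≫ ((MorphismProperty.Over.pullbackComp (P := etaleProp.{u}) (Q := ⊤) f g).hom.app U).left = 𝟙 _ :=
    congr_arg (fun k => k.left) ((MorphismProperty.Over.pullbackComp (P := etaleProp.{u}) (Q := ⊤) f g).inv_hom_id_app U)
  refine (congr_arg (fun k => ((siteFunctorComp f g _ rfl).hom.app U).left ≫ k) this.symm).trans ?_
  exact (Category.assoc _ _ _).symm.trans ((congr_arg (· ≫ _) h2).trans (Category.id_comp _))

lemma siteFunctorComp_assoc {X Y Z T : Scheme.{u}} (f : X ⟶ Y) (g : Y ⟶ Z) (k : Z ⟶ T)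
    (fg : X ⟶ Z) (gk : Y ⟶ T) (fgk : X ⟶ T)
    (w₁ : f ≫ g = fg) (w₂ : g ≫ k = gk) (w₃ : fg ≫ k = fgk) (w₄ : f ≫ gk = fgk) (U : T.Etale) :
    (siteFunctorComp f g fg w₁).hom.app ((siteFunctor k).obj U) ≫ (siteFunctorComp fg k fgk w₃).hom.app U
    = (siteFunctor f).map ((siteFunctorComp g k gk w₂).hom.app U) ≫ (siteFunctorComp f gk fgk w₄).hom.app U := by
  apply site_hom_ext
  have h1 := siteFunctorComp_fst f g fg w₁ ((siteFunctor k).obj U)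
  have h2 := siteFunctorComp_fst fg k fgk w₃ U
  have h3 := siteFunctor_map_fst f ((siteFunctorComp g k gk w₂).hom.app U)
  have h4 := siteFunctorComp_fst f gk fgk w₄ U
  have h5 := siteFunctorComp_fst g k gk w₂ U
  calc _ = ((siteFunctorComp f g fg w₁).hom.app ((siteFunctor k).obj U)).left ≫
        (((siteFunctorComp fg k fgk w₃).hom.app U).left ≫ siteFst fgk U) := Category.assoc _ _ _
    _ = (((siteFunctorComp f g fg w₁).hom.app ((siteFunctor k).obj U)).left ≫ siteFst _ _) ≫ siteFst k U := by
        rw [h2]; exact (Category.assoc _ _ _).symm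
    _ = siteFst f _ ≫ (siteFst g ((siteFunctor k).obj U) ≫ siteFst k U) := by rw [h1]; exact Category.assoc _ _ _
    _ = (((siteFunctor f).map ((siteFunctorComp g k gk w₂).hom.app U)).left ≫ siteFst f _) ≫ siteFst gk U := by
        rw [← h5, h3]; exact (Category.assoc _ _ _).symm
    _ = ((siteFunctor f).map ((siteFunctorComp g k gk w₂).hom.app U)).left ≫ (((siteFunctorComp f gk fgk w₄).hom.app U).left ≫ siteFst _ _) := by
        rw [h4]; exact Category.assoc _ _ _
    _ = _ := (Category.assoc _ _ _).symm

/-- The natural isomorphism `g_* f_* ≅ h_*`, where `h = g ∘ f`. -/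
def directImageComp {X Y Z : Scheme.{u}} (f : X ⟶ Y) (g : Y ⟶ Z) (h : X ⟶ Z) (w : f ≫ g = h) :
    directImage A f ⋙ directImage A g ≅ directImage A h :=
  Functor.sheafPushforwardContinuousComp' (siteFunctorComp f g h w) _ _ _ _

/-- The adjunction `f^* ⊣ f_*`. -/
abbrev inverseImageAdj {X Y : Scheme.{u}} (f : X ⟶ Y) : inverseImage A f ⊣ directImage A f :=
  (siteFunctor f).sheafAdjunctionContinuous (ModuleCat.{u} A) _ _

/-- The natural isomorphism `h^* ≅ f^* g^*`, where `h = g ∘ f`, obtained by adjunction from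
`g_* f_* ≅ h_*`. -/
def inverseImageComp {X Y Z : Scheme.{u}} (f : X ⟶ Y) (g : Y ⟶ Z) (h : X ⟶ Z) (w : f ≫ g = h) :
    inverseImage A h ≅ inverseImage A g ⋙ inverseImage A f :=
  (Adjunction.leftAdjointCompIso (inverseImageAdj A g) (inverseImageAdj A f) (inverseImageAdj A h) (directImageComp A f g h w)).symm

lemma directImageComp_assoc {X Y Z T : Scheme.{u}} (f : X ⟶ Y) (g : Y ⟶ Z) (k : Z ⟶ T)
    (fg : X ⟶ Z) (gk : Y ⟶ T) (fgk : X ⟶ T)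
    (w₁ : f ≫ g = fg) (w₂ : g ≫ k = gk) (w₃ : fg ≫ k = fgk) (w₄ : f ≫ gk = fgk) :
    Functor.isoWhiskerLeft (directImage A f) (directImageComp A g k gk w₂) ≪≫ directImageComp A f gk fgk w₄ =
      (Functor.associator _ _ _).symm ≪≫ Functor.isoWhiskerRight (directImageComp A f g fg w₁) _ ≪≫
        directImageComp A fg k fgk w₃ := by
  apply Iso.ext_inv
  ext F : 4
  funext U
  have := siteFunctorComp_assoc f g k fg gk fgk w₁ w₂ w₃ w₄ U.unop
  have := congr_arg (fun t => F.obj.map t.op) this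
  simp only [op_comp, Functor.map_comp] at this
  simp [directImageComp]
  exact this.symm

lemma inverseImageComp_assoc {X Y Z T : Scheme.{u}} (f : X ⟶ Y) (g : Y ⟶ Z) (k : Z ⟶ T)
    (fg : X ⟶ Z) (gk : Y ⟶ T) (fgk : X ⟶ T)
    (w₁ : f ≫ g = fg) (w₂ : g ≫ k = gk) (w₃ : fg ≫ k = fgk) (w₄ : f ≫ gk = fgk) (F : EtaleSheaf A T) :
    (inverseImageComp A f gk fgk w₄).hom.app F ≫
      (inverseImage A f).map ((inverseImageComp A g k gk w₂).hom.app F) =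
    (inverseImageComp A fg k fgk w₃).hom.app F ≫
      (inverseImageComp A f g fg w₁).hom.app ((inverseImage A k).obj F) := by
  have := Adjunction.leftAdjointCompIso_assoc (inverseImageAdj A k) (inverseImageAdj A g) (inverseImageAdj A f)
    (inverseImageAdj A gk) (inverseImageAdj A fg) (inverseImageAdj A fgk) _ _ _ _ (directImageComp_assoc A f g k fg gk fgk w₁ w₂ w₃ w₄)
  have := congr_arg (fun t => t.inv.app F) this
  simpa [inverseImageComp] using this.symm

/-- Étale sheaves of free `A`-modules: all stalks at geometric points are free. The geometric
points are the morphisms `Spec Ω ⟶ X` with `Ω` a separably closed field. -/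
def freeSheaves (X : Scheme.{u}) : ObjectProperty (EtaleSheaf A X) := fun F =>
  ∀ (Ω : Type u) [Field Ω] [IsSepClosed Ω] (s : Spec (.of Ω) ⟶ X),
    Module.Free A (((Scheme.pointSmallEtale s).sheafFiber (A := ModuleCat.{u} A)).obj F)

/-- `F` is locally constant of finite type: étale locally on `X`, it is the constant sheaf of a
finitely generated `A`-module. -/
def IsFiniteLocallyConstant {X : Scheme.{u}} (F : EtaleSheaf A X) : Prop :=
  ∀ x : X, ∃ (U : Scheme.{u}) (f : U ⟶ X) (_ : Etale f) (_ : x ∈ Set.range f)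
    (M : ModuleCat.{u} A), Module.Finite A M ∧
      Nonempty ((inverseImage A f).obj F ≅
        (constantSheaf U.smallEtaleTopology (ModuleCat.{u} A)).obj M)

/-- `F` is constructible: every affine open subscheme has a finite decomposition into constructible
locally closed subschemes on each of which `F` is locally constant of finite type. -/
def IsConstructible {X : Scheme.{u}} (F : EtaleSheaf A X) : Prop :=
  ∀ U : X.affineOpens, ∃ (n : ℕ) (Z : Fin n → Scheme.{u}) (i : ∀ j, Z j ⟶ (U : X.Opens)),
    (∀ j, IsImmersion (i j)) ∧
    (∀ j, Topology.IsConstructible (Set.range (i j))) ∧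
    (∀ j k, j ≠ k → Disjoint (Set.range (i j)) (Set.range (i k))) ∧
    (⋃ j, Set.range (i j)) = Set.univ ∧
    ∀ j, IsFiniteLocallyConstant A ((inverseImage A (i j ≫ (U : X.Opens).ι)).obj F)

/-- Constructible étale sheaves of free `A`-modules. -/
def constructibleFreeSheaves (X : Scheme.{u}) : ObjectProperty (EtaleSheaf A X) := fun F =>
  freeSheaves A X F ∧ IsConstructible A F

section Galois

variable {X Y : Scheme.{u}} {π : Y ⟶ X} {G : Type u} [Group G]

/-- The automorphism `σ : Y ⟶ Y` over `X` by which `σ : G` acts. -/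
def autHom (ρ : G →* Aut (Over.mk π)) (σ : G) : Y ⟶ Y := (ρ σ).hom.left

lemma autHom_comp (ρ : G →* Aut (Over.mk π)) (σ : G) : autHom ρ σ ≫ π = π := Over.w (ρ σ).hom

/-- `σ * τ` acts as the composition `σ ∘ τ`. -/
lemma autHom_mul (ρ : G →* Aut (Over.mk π)) (σ τ : G) :
    autHom ρ τ ≫ autHom ρ σ = autHom ρ (σ * τ) := by
  simp only [autHom, map_mul]; rfl

/-- The morphism `∐_{σ ∈ G} Y ⟶ Y ×_X Y` given by `y ↦ (y, σ y)` on the copy indexed by `σ`. -/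
def graphMap (ρ : G →* Aut (Over.mk π)) [HasCoproduct fun _ : G => Y] :
    (∐ fun _ : G => Y) ⟶ pullback π π :=
  Sigma.desc fun σ => pullback.lift (𝟙 Y) (autHom ρ σ) (by simp [autHom_comp])

/-- `π : Y ⟶ X` is a finite étale Galois covering with group `G`, acting on `Y` over `X` by `ρ`.
For the full automorphism group of `Y` over `X`, take for `ρ` the identity of `Aut (Over.mk π)`. -/
structure IsGaloisCover (π : Y ⟶ X) (ρ : G →* Aut (Over.mk π)) [Finite G] : Prop where
  finite : IsFinite π
  etale : Etale π
  surjective : Surjective π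
  isIso_graphMap : IsIso (graphMap ρ)

/-- An étale sheaf `F` of `A`-modules on `Y` with isomorphisms `Ψ_σ : F ≅ σ^* F` satisfying the
cocycle condition `τ^*(Ψ_σ) ∘ Ψ_τ = Φ_{σ,τ} ∘ Ψ_{στ}`, where `Φ_{σ,τ} : (στ)^* F ≅ τ^* σ^* F` is the
natural isomorphism. -/
structure EquivariantSheaf (ρ : G →* Aut (Over.mk π)) where
  sheaf : EtaleSheaf A Y
  iso (σ : G) : sheaf ≅ (inverseImage A (autHom ρ σ)).obj sheaf
  cocycle (σ τ : G) :
    (iso τ).hom ≫ (inverseImage A (autHom ρ τ)).map (iso σ).hom =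
      (iso (σ * τ)).hom ≫
        (inverseImageComp A (autHom ρ τ) (autHom ρ σ) (autHom ρ (σ * τ))
          (autHom_mul ρ σ τ)).hom.app sheaf

namespace EquivariantSheaf

variable {A} {ρ : G →* Aut (Over.mk π)}

/-- Morphisms of sheaves `φ` with `Ψ'_σ ∘ φ = σ^*(φ) ∘ Ψ_σ` for all `σ`. -/
@[ext]
structure Hom (M N : EquivariantSheaf A ρ) where
  hom : M.sheaf ⟶ N.sheaf
  comm (σ : G) : hom ≫ (N.iso σ).hom =
    (M.iso σ).hom ≫ (inverseImage A (autHom ρ σ)).map hom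

instance : Category (EquivariantSheaf A ρ) where
  Hom := Hom
  id M := ⟨𝟙 _, fun σ => by simp⟩
  comp f g := ⟨f.hom ≫ g.hom, fun σ => by
    rw [Category.assoc, g.comm, ← Category.assoc, f.comm, Category.assoc, Functor.map_comp]⟩

/-- The functor forgetting the isomorphisms `Ψ_σ`. -/
def forget (A : Type u) [CommRing A] (ρ : G →* Aut (Over.mk π)) :
    EquivariantSheaf A ρ ⥤ EtaleSheaf A Y where
  obj M := M.sheaf
  map f := f.hom

/-- The functor sending `𝒢` on `X` to `π^* 𝒢`, with `Ψ_σ` the natural isomorphism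
`π^* = (π σ)^* ≅ σ^* π^*`. -/
def ofBase (A : Type u) [CommRing A] (ρ : G →* Aut (Over.mk π)) :
    EtaleSheaf A X ⥤ EquivariantSheaf A ρ where
  obj 𝒢 :=
    { sheaf := (inverseImage A π).obj 𝒢
      iso σ := (inverseImageComp A (autHom ρ σ) π π (autHom_comp ρ σ)).app 𝒢
      cocycle σ τ := inverseImageComp_assoc A (autHom ρ τ) (autHom ρ σ) π
        (autHom ρ (σ * τ)) π π (autHom_mul ρ σ τ) (autHom_comp ρ σ) (autHom_comp ρ (σ * τ))
        (autHom_comp ρ τ) 𝒢 }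
  map φ :=
    { hom := (inverseImage A π).map φ
      comm σ := (inverseImageComp A (autHom ρ σ) π π (autHom_comp ρ σ)).hom.naturality φ }
  map_id _ := Hom.ext ((inverseImage A π).map_id _)
  map_comp _ _ := Hom.ext ((inverseImage A π).map_comp _ _)

/-- The category of pairs `(F, (Ψ_σ))` as above such that the sheaf `F` on `Y` satisfies `P`. -/
abbrev WithProp (A : Type u) [CommRing A] (ρ : G →* Aut (Over.mk π)) (P : ObjectProperty (EtaleSheaf A Y)) :=
  (P.inverseImage (forget A ρ)).FullSubcategory

/-- The functor `ofBase`, from the sheaves on `X` satisfying `P` to the pairs `(F, (Ψ_σ))` with `F`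
satisfying `Q`. -/
def restrictedOfBase (ρ : G →* Aut (Over.mk π)) (P : ObjectProperty (EtaleSheaf A X)) (Q : ObjectProperty (EtaleSheaf A Y))
    (h : ∀ 𝒢, P 𝒢 → Q ((inverseImage A π).obj 𝒢)) :
    P.FullSubcategory ⥤ WithProp A ρ Q :=
  (Q.inverseImage (forget A ρ)).lift (P.ι ⋙ ofBase A ρ) fun 𝒢 => h 𝒢.obj 𝒢.property

end EquivariantSheaf

end Galois

/-- The ring of integers of `E`: the integral closure of `ℤ_ℓ` in `E`. -/
def ringOfIntegers (ℓ : ℕ) [Fact ℓ.Prime] (E : Type u) [Field E] [Algebra ℚ_[ℓ] E] : Subring E :=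
  (integralClosure (PadicInt.subring ℓ) E).toSubring

end EtaleDescent

end

open EtaleDescent

/-! Galois descent. The quasi-inverse of `ofBase` sends an equivariant sheaf on `Y` to the subsheaf
of `G`-invariants of its direct image on `X`. The inverse of `Ψ_σ` is adjoint to a map `F ⟶ σ_* F`,
and applying `π_*` gives an action of `σ` on `π_* F`. A morphism `π^* 𝒢 ⟶ F` is equivariant exactly
when its adjoint `𝒢 ⟶ π_* F` is fixed by this action (`comm_iff_action`), so `invariants` represents
equivariant morphisms out of `π^* 𝒢`.

The main point is that `π^*` of the invariants is `F` (`isIso_of_transpose_eq_invariantsι`). Since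
`π` is étale, `π^*` is restriction of the site, and the claim concerns sections over each `V` étale
over `Y`. The Galois condition decomposes `V ×_X Y` into the disjoint translates `σ⁻¹V`; hence an
invariant section over `V ×_X Y` is the same as one section over `V`. This gives essential
surjectivity. Since `π^*` is conservative and faithful for étale surjective `π`, it also gives full
faithfulness.

It remains to see that freeness of stalks and constructibility hold for `𝒢` if and only if they hold
for `π^* 𝒢`. For stalks, the stalk of `π^* 𝒢` at a geometric point is the stalk of `𝒢` at its image,
and geometric points lift along `π`. For constructibility, the finite decomposition is replaced by a
condition at each point, `IsStratified`, tested on reduced schemes over `X`; the equivalence uses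
compactness of the constructible topology. This condition pulls back along any morphism, and
descends along `π` by Chevalley's theorem and discreteness of the fibres. -/

noncomputable section
namespace EtaleDescent

/-! ### Sections of étale sheaves: separation, gluing, isomorphisms -/

section Sections

/-- The objects of the étale site form a type in universe `u + 1`, so limits of that size have to be
preserved. A right adjoint preserves limits of every size. -/
instance forget_hasSheafCompose {C : Type (u + 1)} [Category.{u} C] (J : GrothendieckTopology C)
    (A : Type u) [CommRing A] : J.HasSheafCompose (forget (ModuleCat.{u} A)) := by
  have : PreservesLimitsOfSize.{u + 1, u + 1} (forget (ModuleCat.{u} A)) :=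
    (ModuleCat.adj A).rightAdjoint_preservesLimits
  infer_instance

variable {A : Type u} [CommRing A] {X : Scheme.{u}} (F : EtaleSheaf A X)

lemma map_comp_section {U V W : X.Etale} (g : V ⟶ U) (h : W ⟶ V) (x : F.obj.obj (op U)) :
    F.obj.map h.op (F.obj.map g.op x) = F.obj.map (h ≫ g).op x := by
  rw [op_comp, F.obj.map_comp]; rfl

lemma app_map_section {F F' : EtaleSheaf A X} (φ : F ⟶ F') {U V : X.Etale} (g : V ⟶ U)
    (x : F.obj.obj (op U)) :
    φ.hom.app (op V) (F.obj.map g.op x) = F'.obj.map g.op (φ.hom.app (op U) x) :=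
  ConcreteCategory.congr_hom (φ.hom.naturality g.op) x

lemma isSheafFor_sections {U : X.Etale} {ι : Type*} {V : ι → X.Etale} (g : ∀ i, V i ⟶ U)
    (hg : Sieve.ofArrows V g ∈ X.smallEtaleTopology U) :
    Presieve.IsSheafFor (F.obj ⋙ forget (ModuleCat.{u} A)) (Presieve.ofArrows V g) := by
  have := (isSheaf_iff_isSheaf_of_type _ _).1
    ((sheafCompose X.smallEtaleTopology (forget (ModuleCat.{u} A))).obj F).property _ hg
  rwa [Sieve.ofArrows, ← Presieve.isSheafFor_iff_generate] at this

lemma section_ext {U : X.Etale} {ι : Type*} {V : ι → X.Etale} {g : ∀ i, V i ⟶ U}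
    (hg : Sieve.ofArrows V g ∈ X.smallEtaleTopology U) {x y : F.obj.obj (op U)}
    (h : ∀ i, F.obj.map (g i).op x = F.obj.map (g i).op y) : x = y := by
  refine (isSheafFor_sections F g hg).isSeparatedFor.ext ?_
  rintro _ _ ⟨i⟩
  exact h i

lemma exists_glue {U : X.Etale} {ι : Type*} {V : ι → X.Etale} {g : ∀ i, V i ⟶ U}
    (hg : Sieve.ofArrows V g ∈ X.smallEtaleTopology U) (x : ∀ i, F.obj.obj (op (V i)))
    (h : ∀ (i j : ι) (W : X.Etale) (a : W ⟶ V i) (b : W ⟶ V j), a ≫ g i = b ≫ g j →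
      F.obj.map a.op (x i) = F.obj.map b.op (x j)) :
    ∃ y : F.obj.obj (op U), ∀ i, F.obj.map (g i).op y = x i :=
  ((Presieve.isSheafFor_arrows_iff _ _).1 (isSheafFor_sections F g hg) x
    fun i j W a b e => h i j W a b e).exists

/-- The empty family covers an empty scheme. -/
lemma subsingleton_section {U : X.Etale} (hU : IsEmpty U.left) (x y : F.obj.obj (op U)) :
    x = y := by
  refine section_ext F (ι := PEmpty.{1}) (V := PEmpty.elim) (g := fun i => i.elim) ?_ (fun i => i.elim)
  refine (Scheme.ofArrows_mem_smallEtaleTopology_iff _).2 (Set.eq_univ_of_forall fun x => ?_)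
  exact hU.elim x

lemma bijective_app_of_isIso {F F' : EtaleSheaf A X} (φ : F ⟶ F') [IsIso φ] (U : X.Etale) :
    Function.Bijective (φ.hom.app (op U)) := by
  have : IsIso (φ.hom.app (op U)) := by
    change IsIso (((sheafToPresheaf _ _).map φ).app (op U))
    infer_instance
  exact ConcreteCategory.bijective_of_isIso (φ.hom.app (op U))

lemma isIso_of_bijective_app {F F' : EtaleSheaf A X} (φ : F ⟶ F')
    (h : ∀ U : X.Etale, Function.Bijective (φ.hom.app (op U))) : IsIso φ := by
  have : ∀ U, IsIso (φ.hom.app U) := fun U =>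
    (ConcreteCategory.isIso_iff_bijective _).2 (h U.unop)
  have : IsIso ((sheafToPresheaf _ _).map φ) := NatIso.isIso_of_isIso_app φ.hom
  exact isIso_of_reflects_iso φ (sheafToPresheaf _ _)

lemma ofArrows_siteFunctor_mem {Y : Scheme.{u}} (f : Y ⟶ X) {U : X.Etale} {ι : Type*}
    {V : ι → X.Etale} {g : ∀ i, V i ⟶ U} (hg : Sieve.ofArrows V g ∈ X.smallEtaleTopology U) :
    Sieve.ofArrows _ (fun i => (siteFunctor f).map (g i)) ∈
      Y.smallEtaleTopology ((siteFunctor f).obj U) := by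
  have := (siteFunctor_coverPreserving f).cover_preserve hg
  rwa [Sieve.ofArrows, ← Sieve.generate_map_eq_functorPushforward, Presieve.map_ofArrows] at this

end Sections

/-! ### Inverse image along an étale morphism as restriction of the site -/

section Restriction

variable {X Y : Scheme.{u}} (f : Y ⟶ X) [hf : Etale f]

/-- The functor sending `V` étale over `Y` to `V` viewed as étale over `X`. -/
def etaleMap : Y.Etale ⥤ X.Etale :=
  MorphismProperty.Over.map (P := etaleProp.{u}) ⊤ (f := f) hf

/-- Composition with `f` is left adjoint to base change along `f`. -/
def etaleMapAdj : etaleMap f ⊣ siteFunctor f :=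
  MorphismProperty.Over.mapPullbackAdj etaleProp.{u} ⊤ f hf trivial

lemma etaleMap_coverPreserving :
    CoverPreserving Y.smallEtaleTopology X.smallEtaleTopology (etaleMap f) where
  cover_preserve {U S} hS := by
    obtain ⟨ι, V, g, rfl⟩ := S.exists_eq_ofArrows
    rw [Sieve.ofArrows, ← Sieve.generate_map_eq_functorPushforward, Presieve.map_ofArrows]
    exact (Scheme.ofArrows_mem_smallEtaleTopology_iff _).2
      ((Scheme.ofArrows_mem_smallEtaleTopology_iff g).1 hS)

lemma etaleMap_compatiblePreserving :
    CompatiblePreserving.{u+1} X.smallEtaleTopology (etaleMap f) where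
  compatible := by
    intro ℱ Z T x hx Y₁ Y₂ W f₁ f₂ g₁ g₂ hg₁ hg₂ e
    have e' : f₁.left ≫ g₁.left = f₂.left ≫ g₂.left := congr_arg (fun t => t.left) e
    let l₁ : W.left ⟶ Y₁.left := f₁.left
    let l₂ : W.left ⟶ Y₂.left := f₂.left
    have hl₁ : Etale l₁ := inferInstanceAs (Etale f₁.left)
    -- The object `W` lives over `X` only. It acquires a structure over `Y` through `Y₁`, which
    -- agrees with the one through `Y₂` because both pass through `Z`.
    let W' : Y.Etale := Scheme.Etale.mk (l₁ ≫ Y₁.hom)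
    let f₁' : W' ⟶ Y₁ := MorphismProperty.Over.homMk l₁ rfl trivial
    let f₂' : W' ⟶ Y₂ := MorphismProperty.Over.homMk l₂ (by
      have h1 : g₁.left ≫ Z.hom = Y₁.hom := MorphismProperty.Over.w g₁
      have h2 : g₂.left ≫ Z.hom = Y₂.hom := MorphismProperty.Over.w g₂
      calc l₂ ≫ Y₂.hom = (f₂.left ≫ g₂.left) ≫ Z.hom := by rw [← h2]; exact (Category.assoc _ _ _).symm
        _ = l₁ ≫ Y₁.hom := by rw [← e', ← h1]; exact Category.assoc _ _ _) trivial
    let i : W ⟶ (etaleMap f).obj W' := MorphismProperty.Over.homMk (𝟙 _) (by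
      have h1 : f₁.left ≫ Y₁.hom ≫ f = W.hom := MorphismProperty.Over.w f₁
      exact (Category.id_comp _).trans ((Category.assoc _ _ _).trans h1)) trivial
    have hf₁ : f₁ = i ≫ (etaleMap f).map f₁' :=
      MorphismProperty.Over.Hom.ext (Category.id_comp _).symm
    have hf₂ : f₂ = i ≫ (etaleMap f).map f₂' :=
      MorphismProperty.Over.Hom.ext (Category.id_comp _).symm
    rw [hf₁, hf₂, op_comp, op_comp, ℱ.obj.map_comp, ℱ.obj.map_comp]
    refine congr_arg (ℱ.obj.map i.op) (hx f₁' f₂' hg₁ hg₂ ?_)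
    exact MorphismProperty.Over.Hom.ext e'

instance : (etaleMap f).IsContinuous Y.smallEtaleTopology X.smallEtaleTopology :=
  Functor.isContinuous_of_coverPreserving (etaleMap_compatiblePreserving f)
    (etaleMap_coverPreserving f)

variable (A : Type u) [CommRing A]

/-- The restriction of a sheaf along an étale morphism, given by `V ↦ F(V)`. -/
abbrev restriction : EtaleSheaf A X ⥤ EtaleSheaf A Y :=
  (etaleMap f).sheafPushforwardContinuous (ModuleCat.{u} A) _ _

/-- Restriction along an étale morphism is left adjoint to direct image. -/
def restrictionAdj : restriction f A ⊣ directImage A f :=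
  (etaleMapAdj f).sheafPushforwardContinuous _ _

/-- Along an étale morphism, the inverse image is the restriction. -/
def inverseImageIso : inverseImage A f ≅ restriction f A :=
  (inverseImageAdj A f).leftAdjointUniq (restrictionAdj f A)

lemma ofArrows_counit_mem [Surjective f] (U : X.Etale) :
    Sieve.ofArrows (fun _ : Unit => (etaleMap f).obj ((siteFunctor f).obj U))
      (fun _ => (etaleMapAdj f).counit.app U) ∈ X.smallEtaleTopology U := by
  refine (Scheme.ofArrows_mem_smallEtaleTopology_iff _).2 ?_
  have : Surjective (pullback.fst U.hom f) := inferInstance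
  rw [Set.iUnion_const]
  exact Set.range_eq_univ.2 this.surj

variable {A} in
-- Every `U` is covered by `U ×_X Y`, which lies in the image of `etaleMap f`; so a map bijective on
-- that image is locally bijective.
lemma isIso_of_restriction_map [Surjective f] {F F' : EtaleSheaf A X} (φ : F ⟶ F')
    (h : IsIso ((restriction f A).map φ)) : IsIso φ := by
  have hb (V : Y.Etale) : Function.Bijective (φ.hom.app (op ((etaleMap f).obj V))) :=
    bijective_app_of_isIso ((restriction f A).map φ) V
  have hn {U V : X.Etale} (g : V ⟶ U) (x : F.obj.obj (op U)) := app_map_section φ g x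
  have := forget_hasSheafCompose X.smallEtaleTopology A
  refine (Sheaf.isLocallyBijective_iff_isIso φ).1 ⟨?_, ?_⟩
  · refine ⟨fun {U} x y e => X.smallEtaleTopology.superset_covering ?_
      (ofArrows_counit_mem f U.unop)⟩
    refine (Sieve.generate_le_iff _ _).2 ?_
    rintro _ _ ⟨⟩
    apply (hb _).1
    exact (hn _ x).trans ((congr_arg _ e).trans (hn _ y).symm)
  · refine ⟨fun {U} s => X.smallEtaleTopology.superset_covering ?_ (ofArrows_counit_mem f U)⟩
    refine (Sieve.generate_le_iff _ _).2 ?_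
    rintro _ _ ⟨⟩
    exact (hb _).2 _

variable {A} in
lemma restriction_map_injective [Surjective f] {F F' : EtaleSheaf A X} {φ ψ : F ⟶ F'}
    (h : (restriction f A).map φ = (restriction f A).map ψ) : φ = ψ := by
  ext U x
  refine section_ext F' (ofArrows_counit_mem f U.unop) fun _ => ?_
  refine (app_map_section φ _ x).symm.trans (Eq.trans ?_ (app_map_section ψ _ x))
  exact ConcreteCategory.congr_hom (congr_arg (fun t => t.hom.app (op ((siteFunctor f).obj U.unop))) h) _

end Restriction

/-! ### Adjoint transposes of the natural isomorphisms -/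

section Transpose

lemma homEquiv_conjugateEquiv_comp {C D : Type*} [Category* C] [Category* D] {L₁ L₂ : C ⥤ D}
    {R₁ R₂ : D ⥤ C} (adj₁ : L₁ ⊣ R₁) (adj₂ : L₂ ⊣ R₂) (α : L₂ ⟶ L₁) {c : C} {d : D}
    (k : L₁.obj c ⟶ d) :
    adj₂.homEquiv _ _ (α.app c ≫ k) =
      adj₁.homEquiv _ _ k ≫ (conjugateEquiv adj₁ adj₂ α).app d := by
  rw [adj₁.homEquiv_unit, adj₂.homEquiv_unit, Category.assoc,
    (conjugateEquiv adj₁ adj₂ α).naturality, ← Category.assoc, unit_conjugateEquiv,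
    Category.assoc, R₂.map_comp]

variable (A : Type u) [CommRing A]

/-- Under adjunction, the abstract isomorphism `h^* ≅ f^* g^*` becomes `g_* f_* ≅ h_*`, which is
explicit on sections. Cocycle and equivariance conditions can then be checked on sections. -/
lemma homEquiv_inverseImageComp {X Y Z : Scheme.{u}} (f : X ⟶ Y) (g : Y ⟶ Z) (h : X ⟶ Z)
    (w : f ≫ g = h) {F : EtaleSheaf A Z} {F' : EtaleSheaf A X}
    (k : (inverseImage A f).obj ((inverseImage A g).obj F) ⟶ F') :
    (inverseImageAdj A h).homEquiv _ _ ((inverseImageComp A f g h w).hom.app F ≫ k) =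
      (inverseImageAdj A g).homEquiv _ _ ((inverseImageAdj A f).homEquiv _ _ k) ≫
        (directImageComp A f g h w).hom.app F' := by
  have := homEquiv_conjugateEquiv_comp ((inverseImageAdj A g).comp (inverseImageAdj A f))
    (inverseImageAdj A h) (inverseImageComp A f g h w).hom k
  have h := congr_arg (fun t => t.app F') (Adjunction.conjugateEquiv_leftAdjointCompIso_inv
    (inverseImageAdj A g) (inverseImageAdj A f) (inverseImageAdj A h) (directImageComp A f g h w))
  rw [Adjunction.comp_homEquiv] at this
  exact this.trans (congr_arg (fun t => (inverseImageAdj A g).homEquiv _ _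
    ((inverseImageAdj A f).homEquiv _ _ k) ≫ t) h)

variable {A} in
lemma directImageComp_hom_app {X Y Z : Scheme.{u}} (f : X ⟶ Y) (g : Y ⟶ Z) (h : X ⟶ Z)
    (w : f ≫ g = h) (F : EtaleSheaf A X) (U : Z.Etale) :
    ((directImageComp A f g h w).hom.app F).hom.app (op U) =
      F.obj.map ((siteFunctorComp f g h w).inv.app U).op := by
  simp [directImageComp]
  rfl

variable {A} in
lemma map_iso_inv_eq_iff {X : Scheme.{u}} (F : EtaleSheaf A X) {U V : X.Etale} (e : U ≅ V)
    (x : F.obj.obj (op U)) (y : F.obj.obj (op V)) :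
    F.obj.map e.inv.op x = y ↔ x = F.obj.map e.hom.op y := by
  constructor
  · rintro rfl
    rw [map_comp_section, e.hom_inv_id]; simp
  · rintro rfl
    rw [map_comp_section, e.inv_hom_id]; simp

end Transpose

/-! ### The action of the group on the direct image -/

namespace EquivariantSheaf

variable {X Y : Scheme.{u}} {π : Y ⟶ X} {G : Type u} [Group G] {A : Type u} [CommRing A]
  {ρ : G →* Aut (Over.mk π)}

lemma iso_mul_inv (M : EquivariantSheaf A ρ) (σ τ : G) :
    (M.iso (σ * τ)).inv = (inverseImageComp A _ _ _ (autHom_mul ρ σ τ)).hom.app M.sheaf ≫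
      (inverseImage A (autHom ρ τ)).map (M.iso σ).inv ≫ (M.iso τ).inv := by
  have h := congr_arg (fun t => (M.iso (σ * τ)).inv ≫ t ≫
    (inverseImage A (autHom ρ τ)).map (M.iso σ).inv ≫ (M.iso τ).inv) (M.cocycle σ τ)
  simp only [Category.assoc, Iso.inv_hom_id_assoc] at h
  rw [← h, ← Functor.map_comp_assoc, Iso.hom_inv_id, CategoryTheory.Functor.map_id,
    Category.id_comp, Iso.hom_inv_id, Category.comp_id]

/-- The morphism `F ⟶ σ_* F` adjoint to the inverse of `Ψ_σ`. -/
def transpose (M : EquivariantSheaf A ρ) (σ : G) :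
    M.sheaf ⟶ (directImage A (autHom ρ σ)).obj M.sheaf :=
  (inverseImageAdj A (autHom ρ σ)).homEquiv _ _ (M.iso σ).inv

lemma transpose_mul (M : EquivariantSheaf A ρ) (σ τ : G) :
    M.transpose (σ * τ) = M.transpose σ ≫ (directImage A (autHom ρ σ)).map (M.transpose τ) ≫
      (directImageComp A _ _ _ (autHom_mul ρ σ τ)).hom.app M.sheaf := by
  have h := homEquiv_inverseImageComp A _ _ _ (autHom_mul ρ σ τ)
    ((inverseImage A (autHom ρ τ)).map (M.iso σ).inv ≫ (M.iso τ).inv)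
  rw [← iso_mul_inv, Adjunction.homEquiv_naturality_left,
    Adjunction.homEquiv_naturality_right, Category.assoc] at h
  exact h

/-- The action of `σ` on `π_* F`. -/
def action (M : EquivariantSheaf A ρ) (σ : G) :
    (directImage A π).obj M.sheaf ⟶ (directImage A π).obj M.sheaf :=
  (directImage A π).map (M.transpose σ) ≫
    (directImageComp A _ _ _ (autHom_comp ρ σ)).hom.app M.sheaf

/-- Transpose the equation after composing with the inverse of `Ψ_σ`. This identifies equivariant
morphisms out of `π^* 𝒢` with morphisms from `𝒢` into the invariants of `π_* F`. -/
lemma comm_iff_action (M : EquivariantSheaf A ρ) (𝒢 : EtaleSheaf A X)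
    (k : (inverseImage A π).obj 𝒢 ⟶ M.sheaf) (σ : G) :
    k ≫ (M.iso σ).hom = (inverseImageComp A _ _ _ (autHom_comp ρ σ)).hom.app 𝒢 ≫
        (inverseImage A (autHom ρ σ)).map k ↔
      (inverseImageAdj A π).homEquiv _ _ k ≫ M.action σ = (inverseImageAdj A π).homEquiv _ _ k := by
  have h := homEquiv_inverseImageComp A _ _ _ (autHom_comp ρ σ)
    ((inverseImage A (autHom ρ σ)).map k ≫ (M.iso σ).inv)
  have h0 := Adjunction.homEquiv_naturality_left (inverseImageAdj A (autHom ρ σ)) k (M.iso σ).inv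
  have h1 := Adjunction.homEquiv_naturality_right (inverseImageAdj A π) k (M.transpose σ)
  have h' : _ = (inverseImageAdj A π).homEquiv _ _ k ≫ M.action σ :=
    h.trans ((congr_arg (fun t => (inverseImageAdj A π).homEquiv _ _ t ≫ _) h0).trans
      ((congr_arg (· ≫ _) h1).trans (Category.assoc _ _ _)))
  rw [← h', (Equiv.injective _).eq_iff, ← Category.assoc, Iso.comp_inv_eq, eq_comm]

/-- The map `F(V) → F(σ^{-1} V)` on sections induced by `F ⟶ σ_* F`. -/
def transposeApp (M : EquivariantSheaf A ρ) (σ : G) (V : Y.Etale) (t : M.sheaf.obj.obj (op V)) :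
    M.sheaf.obj.obj (op ((siteFunctor (autHom ρ σ)).obj V)) :=
  (M.transpose σ).hom.app (op V) t

lemma transposeApp_map (M : EquivariantSheaf A ρ) (σ : G) {V W : Y.Etale} (g : W ⟶ V)
    (t : M.sheaf.obj.obj (op V)) :
    M.transposeApp σ W (M.sheaf.obj.map g.op t) =
      M.sheaf.obj.map ((siteFunctor (autHom ρ σ)).map g).op (M.transposeApp σ V t) :=
  app_map_section (M.transpose σ) g t

lemma transposeApp_transposeApp (M : EquivariantSheaf A ρ) (σ τ : G) (V : Y.Etale)
    (t : M.sheaf.obj.obj (op V)) :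
    M.transposeApp τ _ (M.transposeApp σ V t) =
      M.sheaf.obj.map ((siteFunctorComp _ _ _ (autHom_mul ρ σ τ)).hom.app V).op
        (M.transposeApp (σ * τ) V t) := by
  refine (map_iso_inv_eq_iff M.sheaf ((siteFunctorComp _ _ _ (autHom_mul ρ σ τ)).app V) _ _).1 ?_
  have h := congr_arg (fun k => k.hom.app (op V) t) (M.transpose_mul σ τ)
  refine Eq.trans ?_ h.symm
  exact (ConcreteCategory.congr_hom (directImageComp_hom_app _ _ _ (autHom_mul ρ σ τ) M.sheaf V)
    (M.transposeApp τ _ (M.transposeApp σ V t))).symm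

lemma action_eq_self_iff (M : EquivariantSheaf A ρ) (σ : G) (U : X.Etale)
    (s : M.sheaf.obj.obj (op ((siteFunctor π).obj U))) :
    (M.action σ).hom.app (op U) s = s ↔ M.transposeApp σ _ s =
      M.sheaf.obj.map ((siteFunctorComp _ _ _ (autHom_comp ρ σ)).hom.app U).op s := by
  refine Iff.trans ?_
    (map_iso_inv_eq_iff M.sheaf ((siteFunctorComp _ _ _ (autHom_comp ρ σ)).app U) _ _)
  exact Eq.congr_left (ConcreteCategory.congr_hom
    (directImageComp_hom_app _ _ _ (autHom_comp ρ σ) M.sheaf U) (M.transposeApp σ _ s))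

instance isIso_autHom (σ : G) : IsIso (autHom ρ σ) :=
  inferInstanceAs (IsIso ((Over.forget X).mapIso (ρ σ)).hom)

/-- As `σ` is an automorphism, the projection `U ×_{Y,σ} Y ⟶ U` is invertible. So is the unit of
`σ^* ⊣ σ_*`, which is compared with the unit of the restriction adjunction. -/
lemma transposeApp_injective (M : EquivariantSheaf A ρ) (σ : G) (V : Y.Etale) :
    Function.Injective (M.transposeApp σ V) := by
  have h1 : IsIso ((restrictionAdj (autHom ρ σ) A).unit.app M.sheaf) := by
    refine isIso_of_bijective_app _ fun U => ?_
    have h3 : IsIso ((etaleMapAdj (autHom ρ σ)).counit.app U) := by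
      have : IsIso ((Scheme.Etale.forget Y ⋙ Over.forget Y).map
        ((etaleMapAdj (autHom ρ σ)).counit.app U)) :=
        inferInstanceAs (IsIso (pullback.fst U.hom (autHom ρ σ)))
      exact isIso_of_reflects_iso _ (Scheme.Etale.forget Y ⋙ Over.forget Y)
    exact ConcreteCategory.bijective_of_isIso
      (M.sheaf.obj.map ((etaleMapAdj (autHom ρ σ)).counit.app U).op)
  have h2 : IsIso (M.transpose σ) := by
    have h := Adjunction.unit_leftAdjointUniq_hom_app (restrictionAdj (autHom ρ σ) A)
      (inverseImageAdj A (autHom ρ σ)) M.sheaf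
    have h4 : IsIso ((inverseImageAdj A (autHom ρ σ)).unit.app M.sheaf) := by
      rw [← h]; infer_instance
    rw [transpose, Adjunction.homEquiv_unit]
    infer_instance
  exact (bijective_app_of_isIso _ V).1

end EquivariantSheaf

namespace EquivariantSheaf

variable {X Y : Scheme.{u}} {π : Y ⟶ X} {G : Type u} [Group G] {A : Type u} [CommRing A]
  {ρ : G →* Aut (Over.mk π)}

/-! ### The sheaf of invariants -/

section Invariants

variable (M : EquivariantSheaf A ρ)

/-- The subsheaf of `G`-invariants of `π_* F`. -/
def invariants : EtaleSheaf A X :=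
  equalizer (Pi.lift fun σ : G => M.action σ)
    (Pi.lift fun _ : G => 𝟙 ((directImage A π).obj M.sheaf))

/-- The inclusion of the invariants in `π_* F`. -/
def invariantsι : M.invariants ⟶ (directImage A π).obj M.sheaf := equalizer.ι _ _

lemma invariantsι_action (σ : G) : M.invariantsι ≫ M.action σ = M.invariantsι := by
  have h := equalizer.condition (Pi.lift fun σ : G => M.action σ)
    (Pi.lift fun _ : G => 𝟙 ((directImage A π).obj M.sheaf)) =≫ Pi.π _ σ
  simp only [Category.assoc, Pi.lift_π, Category.comp_id] at h
  exact h

lemma exists_invariantsι_comp {𝒢 : EtaleSheaf A X} (k : 𝒢 ⟶ (directImage A π).obj M.sheaf)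
    (h : ∀ σ, k ≫ M.action σ = k) : ∃ l : 𝒢 ⟶ M.invariants, l ≫ M.invariantsι = k :=
  ⟨equalizer.lift k (Pi.hom_ext _ _ fun σ => by simpa using h σ), equalizer.lift_ι _ _⟩

/-- Limits of sheaves are computed on sections, so sections of the equalizer are exactly the
invariant sections. -/
lemma existsUnique_invariantsι_app (U : X.Etale) (s : M.sheaf.obj.obj (op ((siteFunctor π).obj U)))
    (h : ∀ σ, (M.action σ).hom.app (op U) s = s) :
    ∃! x : M.invariants.obj.obj (op U), M.invariantsι.hom.app (op U) x = s := by
  let E : EtaleSheaf A X ⥤ Type u := sheafToPresheaf _ _ ⋙ (evaluation _ _).obj (op U) ⋙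
    CategoryTheory.forget (ModuleCat.{u} A)
  have : PreservesLimitsOfSize.{0, u} E := by
    dsimp only [E]; infer_instance
  have : PreservesLimitsOfSize.{0, 0} E := preservesLimitsOfSize_shrink.{0, 0, 0, u} E
  have := (Types.type_equalizer_iff_unique _ _).1
    ⟨isLimitForkMapOfIsLimit E _ (equalizerIsEqualizer (Pi.lift fun σ : G => M.action σ)
      (Pi.lift fun _ : G => 𝟙 ((directImage A π).obj M.sheaf)))⟩ s
  refine this ?_
  refine Concrete.isLimit_ext _ (isLimitOfPreserves E (limit.isLimit _)) _ _ ?_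
  rintro ⟨σ⟩
  have h1 := congr_arg (fun t => t.hom.app (op U) s) (Pi.lift_π (fun σ : G => M.action σ) σ)
  have h2 := congr_arg (fun t => t.hom.app (op U) s)
    (Pi.lift_π (fun _ : G => 𝟙 ((directImage A π).obj M.sheaf)) σ)
  exact (h1.trans (h σ)).trans h2.symm

end Invariants

/-! ### Decomposition of `V ×_X Y` into translates of `V` -/

section Cover

lemma comp_comp_eq_of_eq {C : Type*} [Category* C] {P Q R S T T' : C} {m : P ⟶ Q} {c : Q ⟶ R}
    {p : R ⟶ S} {f₁ : Q ⟶ T} {f₂ : T ⟶ S} {n : P ⟶ T'} {g : T' ⟶ T} {t : T' ⟶ S}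
    (h₁ : c ≫ p = f₁ ≫ f₂) (h₂ : m ≫ f₁ = n ≫ g) (h₃ : g ≫ f₂ = t) :
    (m ≫ c) ≫ p = n ≫ t := by
  rw [Category.assoc, h₁, ← Category.assoc, h₂, Category.assoc, h₃]

lemma comp_comp_eq_of_comp_eq {C : Type*} [Category* C] {P Q R S : C} {m : P ⟶ Q} {c : Q ⟶ R}
    {p : R ⟶ S} {f : Q ⟶ S} {s : P ⟶ S} (h₁ : s = m ≫ f) (h₂ : c ≫ p = f) :
    (m ≫ c) ≫ p = s := by
  rw [Category.assoc, h₂, h₁]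

lemma ι_graphMap (σ : G) [HasCoproduct fun _ : G => Y] :
    Sigma.ι (fun _ : G => Y) σ ≫ graphMap ρ = pullback.lift (𝟙 Y) (autHom ρ σ)
      ((Category.id_comp _).trans (autHom_comp ρ σ).symm) :=
  Sigma.ι_desc _ _

/-- Since `graphMap` is a monomorphism, `q` would map `W` into two different copies of `Y` in the
disjoint union, and these do not meet. -/
lemma isEmpty_of_comp_autHom_eq [Finite G] (hπ : IsGaloisCover π ρ) {σ τ : G} (hστ : σ ≠ τ) {W : Scheme.{u}}
    (q : W ⟶ Y) (h : q ≫ autHom ρ σ = q ≫ autHom ρ τ) : IsEmpty W := by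
  have := hπ.isIso_graphMap
  refine isEmpty_of_commSq_sigmaι_of_ne (g := fun _ : G => Y) (a := q) (b := q) ⟨?_⟩ hστ
  rw [← cancel_mono (graphMap ρ), Category.assoc, Category.assoc, ι_graphMap, ι_graphMap]
  apply pullback.hom_ext
  · simp only [Category.assoc, pullback.lift_fst]
  · simp only [Category.assoc, pullback.lift_snd, h]

variable [Etale π]

/-- The graph `V ⟶ V ×_X Y`. -/
def graphHom (V : Y.Etale) : V ⟶ (siteFunctor π).obj ((etaleMap π).obj V) :=
  (etaleMapAdj π).unit.app V

lemma graphHom_fst (V : Y.Etale) :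
    (graphHom (π := π) V).left ≫ siteFst π ((etaleMap π).obj V) = 𝟙 V.left :=
  pullback.lift_fst _ _ _

variable (ρ) in
/-- The morphism `σ^{-1} V = V ×_{Y,σ} Y ⟶ V ×_X Y`. -/
def translate (σ : G) (V : Y.Etale) :
    (siteFunctor (autHom ρ σ)).obj V ⟶ (siteFunctor π).obj ((etaleMap π).obj V) :=
  (siteFunctor (autHom ρ σ)).map (graphHom V) ≫
    (siteFunctorComp _ _ _ (autHom_comp ρ σ)).hom.app ((etaleMap π).obj V)

lemma translate_fst (σ : G) (V : Y.Etale) :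
    (translate ρ σ V).left ≫ siteFst π ((etaleMap π).obj V) = siteFst (autHom ρ σ) V := by
  have h1 := siteFunctorComp_fst _ _ _ (autHom_comp ρ σ) ((etaleMap π).obj V)
  have h2 := siteFunctor_map_fst (autHom ρ σ) (graphHom (π := π) V)
  exact (comp_comp_eq_of_eq h1 h2 (graphHom_fst V)).trans (Category.comp_id _)

/-- Both sides have the same projection to `V`. This compatibility makes the glued section in the
descent argument invariant. -/
lemma translate_mul (σ τ : G) (V : Y.Etale) :
    (siteFunctor (autHom ρ τ)).map (translate ρ σ V) ≫
        (siteFunctorComp _ _ _ (autHom_comp ρ τ)).hom.app ((etaleMap π).obj V) =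
      (siteFunctorComp _ _ _ (autHom_mul ρ σ τ)).hom.app V ≫ translate ρ (σ * τ) V := by
  apply site_hom_ext
  have h1 := siteFunctorComp_fst _ _ _ (autHom_comp ρ τ) ((etaleMap π).obj V)
  have h2 := siteFunctor_map_fst (autHom ρ τ) (translate ρ σ V)
  have h3 := siteFunctorComp_fst _ _ _ (autHom_mul ρ σ τ) V
  have h4 := comp_comp_eq_of_comp_eq h3.symm (translate_fst (σ * τ) V)
  have h5 := comp_comp_eq_of_eq h1 h2 (translate_fst σ V)
  exact h5.trans h4.symm

variable [Finite G]

lemma ofArrows_translate_mem (hπ : IsGaloisCover π ρ) (V : Y.Etale) :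
    Sieve.ofArrows _ (fun σ : G => translate ρ σ V) ∈
      Y.smallEtaleTopology ((siteFunctor π).obj ((etaleMap π).obj V)) := by
  refine (Scheme.ofArrows_mem_smallEtaleTopology_iff _).2 (Set.eq_univ_of_forall fun z => ?_)
  have := hπ.isIso_graphMap
  let Z : Scheme.{u} := pullback (V.hom ≫ π) π
  -- The coordinates are exchanged: `graphMap` sends `y` to `(y, σ y)`, so a point `(v, y)` of `V
  -- ×_X Y` should lie over `(y, v)`. It belongs to the copy `σ` when `v` lies over `σ y`, that is,
  -- when it comes from `V ×_{Y,σ} Y`.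
  let m : Z ⟶ pullback π π := pullback.lift (pullback.snd _ _) (pullback.fst _ _ ≫ V.hom)
    (by rw [Category.assoc]; exact pullback.condition.symm)
  obtain ⟨c, hc⟩ := (inferInstance : Surjective (graphMap ρ)).surj (m z)
  obtain ⟨(σ : G), (y : Y), rfl⟩ := (sigmaOpenCover fun _ : G => Y).exists_eq c
  have hc' : m z = (Sigma.ι (fun _ : G => Y) σ ≫ graphMap ρ) y := hc.symm
  obtain ⟨w, hw, -⟩ := Scheme.Pullback.exists_preimage_pullback z y hc'
  refine Set.mem_iUnion.2 ⟨σ, ?_⟩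
  have hp : pullback.fst m (Sigma.ι (fun _ : G => Y) σ ≫ graphMap ρ) ≫ m =
      pullback.snd m (Sigma.ι (fun _ : G => Y) σ ≫ graphMap ρ) ≫
        pullback.lift (𝟙 Y) (autHom ρ σ)
          ((Category.id_comp _).trans (autHom_comp ρ σ).symm) := by
    rw [pullback.condition, ι_graphMap]
  have hp1 := hp =≫ pullback.fst _ _
  have hp2 := hp =≫ pullback.snd _ _
  simp only [m, Category.assoc, pullback.lift_fst, pullback.lift_snd, Category.comp_id] at hp1 hp2
  let l : pullback m (Sigma.ι (fun _ : G => Y) σ ≫ graphMap ρ) ⟶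
      ((siteFunctor (autHom ρ σ)).obj V).left :=
    pullback.lift (pullback.fst _ _ ≫ pullback.fst _ _) (pullback.snd _ _)
      ((Category.assoc _ _ _).trans hp2)
  have hl : l ≫ (translate ρ σ V).left = pullback.fst _ _ := by
    apply pullback.hom_ext
    · exact (Category.assoc _ _ _).trans ((congr_arg (l ≫ ·) (translate_fst σ V)).trans
        (pullback.lift_fst _ _ _))
    · exact (Category.assoc _ _ _).trans ((congr_arg (l ≫ ·)
        (MorphismProperty.Over.w (translate ρ σ V))).trans ((pullback.lift_snd _ _ _).trans hp1.symm))
  exact ⟨l w, (congr_arg (fun t : pullback m (Sigma.ι (fun _ : G => Y) σ ≫ graphMap ρ) ⟶ Z => t w)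
    hl).trans hw⟩

end Cover

/-! ### The inverse image of the invariants is the original sheaf -/

section Descent

variable [Finite G]

lemma isIso_of_transpose_eq_invariantsι (hπ : IsGaloisCover π ρ) (M : EquivariantSheaf A ρ)
    (k : (inverseImage A π).obj M.invariants ⟶ M.sheaf)
    (hk : (inverseImageAdj A π).homEquiv _ _ k = M.invariantsι) : IsIso k := by
  have := hπ.etale
  let k' : (restriction π A).obj M.invariants ⟶ M.sheaf :=
    -- In terms of restriction, the map sends an invariant section over `V ×_X Y` to its pullback
    -- along the graph of `V`.
    (restriction π A).map M.invariantsι ≫ (restrictionAdj π A).counit.app _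
  have e : k = (inverseImageIso π A).hom.app _ ≫ k' := by
    have h := Adjunction.leftAdjointUniq_hom_app_counit (inverseImageAdj A π) (restrictionAdj π A)
      M.sheaf
    have hk' : k = ((inverseImageAdj A π).homEquiv _ _).symm M.invariantsι := by
      rw [← hk, Equiv.symm_apply_apply]
    rw [hk', Adjunction.homEquiv_counit, ← h]
    exact (Category.assoc _ _ _).symm.trans ((congr_arg (· ≫ _)
      ((inverseImageIso π A).hom.naturality M.invariantsι)).trans (Category.assoc _ _ _))
  suffices IsIso k' by rw [e]; infer_instance
  refine isIso_of_bijective_app _ fun V => ?_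
  have hk' (x : M.invariants.obj.obj (op ((etaleMap π).obj V))) : k'.hom.app (op V) x =
      M.sheaf.obj.map (graphHom V).op (M.invariantsι.hom.app (op ((etaleMap π).obj V)) x) := rfl
  have hcov := ofArrows_translate_mem hπ V
  -- An invariant section is determined on every translate by its restriction to the graph.
  have hinv (s : M.sheaf.obj.obj (op ((siteFunctor π).obj ((etaleMap π).obj V)))) (σ : G)
      (hs : (M.action σ).hom.app (op ((etaleMap π).obj V)) s = s) :
      M.transposeApp σ V (M.sheaf.obj.map (graphHom V).op s) =
        M.sheaf.obj.map (translate ρ σ V).op s := by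
    rw [transposeApp_map, (M.action_eq_self_iff σ _ s).1 hs, map_comp_section]
    rfl
  have hι (x : M.invariants.obj.obj (op ((etaleMap π).obj V))) (σ : G) :
      (M.action σ).hom.app (op ((etaleMap π).obj V))
        (M.invariantsι.hom.app (op ((etaleMap π).obj V)) x) =
      M.invariantsι.hom.app (op ((etaleMap π).obj V)) x :=
    congr_arg (fun t => t.hom.app (op ((etaleMap π).obj V)) x) (M.invariantsι_action σ)
  constructor
  · intro x y hxy
    have hxy' := (hk' x).symm.trans (hxy.trans (hk' y))
    refine (M.existsUnique_invariantsι_app _ _ (hι x)).unique rfl (Eq.symm ?_)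
    refine section_ext M.sheaf hcov fun σ => ?_
    rw [← hinv _ σ (hι x σ), ← hinv _ σ (hι y σ), hxy']
  · intro t
    -- The transforms of `t` on the translates glue: distinct translates have empty overlap, and on
    -- a single one there is nothing to compare, since a map into it is determined by its projection
    -- to `V`.
    obtain ⟨s, hs⟩ := exists_glue M.sheaf hcov (fun σ => M.transposeApp σ V t) (by
      intro σ τ W a b hab
      have hfst : a.left ≫ siteFst (autHom ρ σ) V = b.left ≫ siteFst (autHom ρ τ) V := by
        have := congr_arg (fun t => t.left ≫ siteFst π ((etaleMap π).obj V)) hab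
        exact (congr_arg (a.left ≫ ·) (translate_fst σ V)).symm.trans
          ((Category.assoc _ _ _).symm.trans (this.trans ((Category.assoc _ _ _).trans
          (congr_arg (b.left ≫ ·) (translate_fst τ V)))))
      by_cases hστ : σ = τ
      · subst hστ
        rw [site_hom_ext _ hfst]
      · refine subsingleton_section _ (isEmpty_of_comp_autHom_eq hπ hστ W.hom ?_) _ _
        have hW (σ : G) (c : W.left ⟶ pullback V.hom (autHom ρ σ))
            (hc : c ≫ pullback.snd V.hom (autHom ρ σ) = W.hom) :
            W.hom ≫ autHom ρ σ = (c ≫ pullback.fst V.hom (autHom ρ σ)) ≫ V.hom := by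
          rw [← hc, Category.assoc, ← pullback.condition, Category.assoc]
        exact (hW σ a.left (MorphismProperty.Over.w a)).trans ((congr_arg (· ≫ V.hom) hfst).trans
          (hW τ b.left (MorphismProperty.Over.w b)).symm))
    -- By the cocycle condition, transforming by `σ` and then by `τ` is transforming by `σ * τ`, so
    -- the action only permutes the pieces of `s`.
    have hact (τ : G) : (M.action τ).hom.app (op ((etaleMap π).obj V)) s = s := by
      refine (M.action_eq_self_iff τ _ s).2 ?_
      refine section_ext M.sheaf (ofArrows_siteFunctor_mem (autHom ρ τ) hcov) fun σ => ?_
      rw [← transposeApp_map, hs, transposeApp_transposeApp, ← hs, map_comp_section,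
        ← translate_mul]
      exact (map_comp_section _ _ _ _).symm
    obtain ⟨x, hx, -⟩ := M.existsUnique_invariantsι_app _ s hact
    -- Any element of `G` would serve: on its translate, `s` is the transform both of its
    -- restriction to the graph and of `t`, and the transform is injective.
    refine ⟨x, M.transposeApp_injective 1 V ?_⟩
    rw [show k'.hom.app (op V) x = _ from hk' x, hx, hinv s 1 (hact 1), hs]

end Descent

end EquivariantSheaf

/-! ### Inverse image along an étale surjection is conservative and faithful -/

section Conservative

variable {X Y : Scheme.{u}} (f : Y ⟶ X) [Etale f] [Surjective f] {A : Type u} [CommRing A]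
  {F F' : EtaleSheaf A X}

lemma isIso_of_inverseImage_map (φ : F ⟶ F') (h : IsIso ((inverseImage A f).map φ)) :
    IsIso φ :=
  isIso_of_restriction_map f φ ((NatIso.isIso_map_iff (inverseImageIso f A) φ).1 h)

lemma inverseImage_map_injective {φ ψ : F ⟶ F'}
    (h : (inverseImage A f).map φ = (inverseImage A f).map ψ) : φ = ψ := by
  apply restriction_map_injective f
  rw [← cancel_epi ((inverseImageIso f A).hom.app F), ← NatTrans.naturality,
    ← NatTrans.naturality, h]

end Conservative

/-! ### The equivalence of categories and its restriction to subcategories -/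

namespace EquivariantSheaf

variable {X Y : Scheme.{u}} {π : Y ⟶ X} {G : Type u} [Group G] {A : Type u} [CommRing A]
  {ρ : G →* Aut (Over.mk π)}

/-- A morphism of equivariant sheaves whose underlying morphism is invertible is invertible. -/
def isoMk {M N : EquivariantSheaf A ρ} (φ : M ⟶ N) (h : IsIso φ.hom) : M ≅ N where
  hom := φ
  inv := ⟨inv φ.hom, fun σ => by
    rw [IsIso.inv_comp_eq, ← Category.assoc, φ.comm, Category.assoc, ← Functor.map_comp,
      IsIso.hom_inv_id, CategoryTheory.Functor.map_id, Category.comp_id]⟩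
  hom_inv_id := Hom.ext (IsIso.hom_inv_id _)
  inv_hom_id := Hom.ext (IsIso.inv_hom_id _)

/-- The morphism of equivariant sheaves from the inverse image of the invariants. -/
def ofInvariants (M : EquivariantSheaf A ρ) : (ofBase A ρ).obj M.invariants ⟶ M where
  hom := ((inverseImageAdj A π).homEquiv _ _).symm M.invariantsι
  comm σ := (M.comm_iff_action _ _ σ).2 (by
    rw [Equiv.apply_symm_apply, invariantsι_action])

lemma isIso_ofInvariants_hom [Finite G] (hπ : IsGaloisCover π ρ) (M : EquivariantSheaf A ρ) :
    IsIso M.ofInvariants.hom :=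
  isIso_of_transpose_eq_invariantsι hπ M _ (Equiv.apply_symm_apply _ _)

lemma ofBase_essSurj [Finite G] (hπ : IsGaloisCover π ρ) : (ofBase A ρ).EssSurj where
  mem_essImage M := ⟨M.invariants, ⟨isoMk _ (isIso_ofInvariants_hom hπ M)⟩⟩

lemma ofBase_faithful [Finite G] (hπ : IsGaloisCover π ρ) : (ofBase A ρ).Faithful where
  map_injective h := by
    have := hπ.etale
    have := hπ.surjective
    exact inverseImage_map_injective π (congr_arg Hom.hom h)

lemma exists_comp_ofInvariants {𝒢 : EtaleSheaf A X} {M : EquivariantSheaf A ρ}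
    (φ : (ofBase A ρ).obj 𝒢 ⟶ M) :
    ∃ l : 𝒢 ⟶ M.invariants, (ofBase A ρ).map l ≫ M.ofInvariants = φ := by
  obtain ⟨l, hl⟩ := M.exists_invariantsι_comp ((inverseImageAdj A π).homEquiv _ _ φ.hom)
    fun σ => (M.comm_iff_action _ _ σ).1 (φ.comm σ)
  refine ⟨l, Hom.ext ?_⟩
  refine ((inverseImageAdj A π).homEquiv _ _).injective (Eq.trans ?_ hl)
  refine ((inverseImageAdj A π).homEquiv_naturality_left _ _).trans (congr_arg (l ≫ ·) ?_)
  exact Equiv.apply_symm_apply _ _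

/-- Factor the identity of `π^* 𝒢'` through its invariants by `e`. As `ofInvariants` is invertible,
`π^* e` is, and hence so is `e`. A morphism `π^* 𝒢 ⟶ π^* 𝒢'` corresponds to a map `l` into the
invariants, and `l ≫ inv e` lifts it. -/
lemma ofBase_full [Finite G] (hπ : IsGaloisCover π ρ) : (ofBase A ρ).Full where
  map_surjective {𝒢 𝒢'} φ := by
    have := hπ.etale
    have := hπ.surjective
    obtain ⟨l, hl⟩ := exists_comp_ofInvariants φ
    obtain ⟨e, he⟩ := exists_comp_ofInvariants (𝟙 ((ofBase A ρ).obj 𝒢'))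
    have h1 := isIso_ofInvariants_hom hπ ((ofBase A ρ).obj 𝒢')
    have h2 : IsIso ((inverseImage A π).map e) := by
      have h := congr_arg Hom.hom he
      have h' : (inverseImage A π).map e ≫ ((ofBase A ρ).obj 𝒢').ofInvariants.hom = 𝟙 _ := h
      exact @IsIso.of_isIso_fac_right _ _ _ _ _ _ _ _ h1 (inferInstanceAs (IsIso (𝟙 _))) h'
    have h3 : IsIso e := isIso_of_inverseImage_map π e h2
    refine ⟨l ≫ inv e, ?_⟩
    have h4 : (ofBase A ρ).map (inv e) = ((ofBase A ρ).obj 𝒢').ofInvariants := by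
      rw [Functor.map_inv, IsIso.inv_eq_of_hom_inv_id he]
    rw [Functor.map_comp, h4, hl]

lemma restrictedOfBase_isEquivalence [Finite G] (hπ : IsGaloisCover π ρ) {P : ObjectProperty (EtaleSheaf A X)}
    {Q : ObjectProperty (EtaleSheaf A Y)} [Q.IsClosedUnderIsomorphisms]
    (h : ∀ 𝒢, P 𝒢 → Q ((inverseImage A π).obj 𝒢))
    (h' : ∀ 𝒢, Q ((inverseImage A π).obj 𝒢) → P 𝒢) :
    (restrictedOfBase ρ P Q h).IsEquivalence := by
  have := ofBase_full (A := A) hπ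
  have := ofBase_faithful (A := A) hπ
  have := ofBase_essSurj (A := A) hπ
  have hc : (P.ι ⋙ ofBase A ρ).Full := Functor.Full.comp _ _
  have hc' : (P.ι ⋙ ofBase A ρ).Faithful := Functor.Faithful.comp _ _
  let i : restrictedOfBase ρ P Q h ⋙ (Q.inverseImage (forget A ρ)).ι ≅ P.ι ⋙ ofBase A ρ :=
    Iso.refl _
  have h1 : (restrictedOfBase ρ P Q h).Full := Functor.Full.of_comp_faithful_iso i
  have h2 : (restrictedOfBase ρ P Q h).Faithful := Functor.Faithful.of_comp_iso i
  have h3 : (restrictedOfBase ρ P Q h).EssSurj := ⟨fun N => by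
    let e := (ofBase A ρ).objObjPreimageIso N.obj
    have hP : P ((ofBase A ρ).objPreimage N.obj) :=
      h' _ (Q.prop_of_iso ((forget A ρ).mapIso e).symm N.property)
    exact ⟨⟨_, hP⟩, ⟨(Q.inverseImage (forget A ρ)).isoMk e⟩⟩⟩
  exact {}

end EquivariantSheaf

/-! ### Stalks at geometric points -/

section Stalks

variable {X Y : Scheme.{u}} (f : Y ⟶ X) {Ω : Type u} [Field Ω] [IsSepClosed Ω]
  (s : Spec (.of Ω) ⟶ Y)

/-- The lifts of a geometric point of `Y` to `U ×_X Y` are the lifts of its image to `U`. -/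
def fiberIso : siteFunctor f ⋙ (Scheme.pointSmallEtale s).fiber ≅
    (Scheme.pointSmallEtale (s ≫ f)).fiber :=
  NatIso.ofComponents (fun U => Equiv.toIso
    { toFun t := Over.homMk (t.left ≫ pullback.fst U.hom f) (by
        have h (r : Spec (.of Ω) ⟶ pullback U.hom f) (hr : r ≫ pullback.snd U.hom f = s) :
            (r ≫ pullback.fst U.hom f) ≫ U.hom = s ≫ f := by
          rw [← hr, Category.assoc, pullback.condition, Category.assoc]
        exact h t.left (Over.w t))
      invFun t := Over.homMk (pullback.lift t.left s (Over.w t)) (pullback.lift_snd _ _ _)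
      left_inv t := by
        apply Over.OverMorphism.ext
        apply pullback.hom_ext
        · exact pullback.lift_fst _ _ _
        · exact (pullback.lift_snd _ _ _).trans (Over.w t).symm
      right_inv t := by
        apply Over.OverMorphism.ext
        exact pullback.lift_fst _ _ _ })
    (by
      intro U V a
      ext t
      apply Over.OverMorphism.ext
      have h := siteFunctor_map_fst f a
      exact (Category.assoc _ _ _).trans ((congr_arg (t.left ≫ ·) h).trans
        (Category.assoc _ _ _).symm))

variable (A : Type u) [CommRing A]

/-- The direct image of a skyscraper sheaf is a skyscraper sheaf. -/
def skyscraperIso : (Scheme.pointSmallEtale s).skyscraperSheafFunctor ⋙ directImage A f ≅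
    (Scheme.pointSmallEtale (s ≫ f)).skyscraperSheafFunctor (A := ModuleCat.{u} A) :=
  -- The sections of a skyscraper sheaf over `U` are a product indexed by the lifts of the point to
  -- `U`, so `fiberIso` gives the comparison.
  let i : (Functor.flip ((siteFunctor f ⋙ (Scheme.pointSmallEtale s).fiber).op ⋙
      (piFunctor.{u} (C := ModuleCat.{u} A)).flip)) ≅ Functor.flip (((Scheme.pointSmallEtale (s ≫ f)).fiber).op ⋙
      (piFunctor.{u}).flip) :=
    (flipFunctor _ _ _).mapIso (Functor.isoWhiskerRight (NatIso.op (fiberIso f s).symm) _)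
  (fullyFaithfulSheafToPresheaf _ _).whiskeringRight _ |>.preimageIso i

/-- The stalk of the inverse image at a geometric point is the stalk at the image. -/
def stalkIso : inverseImage A f ⋙ (Scheme.pointSmallEtale s).sheafFiber ≅
    (Scheme.pointSmallEtale (s ≫ f)).sheafFiber :=
  -- The two functors are left adjoint to the skyscraper functors compared in `skyscraperIso`.
  (conjugateIsoEquiv ((inverseImageAdj A f).comp
    (Scheme.pointSmallEtale s).skyscraperSheafAdjunction)
    (Scheme.pointSmallEtale (s ≫ f)).skyscraperSheafAdjunction).symm (skyscraperIso f s A) |>.symm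

variable {A}

lemma free_stalk_inverseImage_iff (F : EtaleSheaf A X) :
    Module.Free A (((Scheme.pointSmallEtale s).sheafFiber (A := ModuleCat.{u} A)).obj ((inverseImage A f).obj F)) ↔
      Module.Free A
        (((Scheme.pointSmallEtale (s ≫ f)).sheafFiber (A := ModuleCat.{u} A)).obj F) :=
  Module.Free.iff_of_equiv ((stalkIso f s A).app F).toLinearEquiv

lemma freeSheaves_inverseImage {F : EtaleSheaf A X} (h : freeSheaves A X F) :
    freeSheaves A Y ((inverseImage A f).obj F) := fun Ω _ _ s =>
  (free_stalk_inverseImage_iff f s F).2 (h Ω (s ≫ f))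

/-- Over a separably closed field, a geometric point of `X` lifts along an étale surjection, so
every stalk of `F` is a stalk of the inverse image. -/
lemma freeSheaves_of_inverseImage [Etale f] [Surjective f] {F : EtaleSheaf A X}
    (h : freeSheaves A Y ((inverseImage A f).obj F)) : freeSheaves A X F := fun Ω _ _ s => by
  obtain ⟨y, hy⟩ := f.surjective (s default)
  obtain ⟨t, rfl, -⟩ := Scheme.exists_fac_of_etale_of_isSepClosed f s y hy
  exact (free_stalk_inverseImage_iff f t F).1 (h Ω t)

instance : (freeSheaves A X).IsClosedUnderIsomorphisms where
  of_iso {F F'} e h Ω _ _ s := by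
    have := h Ω s
    exact Module.Free.of_equiv ((Scheme.pointSmallEtale s).sheafFiber.mapIso e).toLinearEquiv

end Stalks

/-! ### Locally constant sheaves -/

section LocallyConstant

variable {X Y Z : Scheme.{u}} (A : Type u) [CommRing A]

/-- The inverse image of a constant sheaf is the constant sheaf with the same value. -/
def constantSheafInverseImageIso (f : Y ⟶ X) :
    constantSheaf X.smallEtaleTopology (ModuleCat.{u} A) ⋙ inverseImage A f ≅
      constantSheaf Y.smallEtaleTopology (ModuleCat.{u} A) :=
  -- Both functors are left adjoint to sections over a terminal object, because base change
  -- preserves the terminal object.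
  have hT : IsTerminal (⊤_ X.Etale) := terminalIsTerminal
  ((constantSheafAdj X.smallEtaleTopology (ModuleCat.{u} A) hT).comp
    (inverseImageAdj A f)).leftAdjointUniq
    (constantSheafAdj Y.smallEtaleTopology (ModuleCat.{u} A) (hT.isTerminalObj (siteFunctor f)))

variable {A}

lemma IsFiniteLocallyConstant.of_iso {F F' : EtaleSheaf A X} (e : F ≅ F')
    (h : IsFiniteLocallyConstant A F) : IsFiniteLocallyConstant A F' := fun x => by
  obtain ⟨U, f, hf, hx, M, hM, ⟨i⟩⟩ := h x
  exact ⟨U, f, hf, hx, M, hM, ⟨(inverseImage A f).mapIso e.symm ≪≫ i⟩⟩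

lemma isFiniteLocallyConstant_comp_iff (f : Z ⟶ Y) (g : Y ⟶ X) (F : EtaleSheaf A X) :
    IsFiniteLocallyConstant A ((inverseImage A (f ≫ g)).obj F) ↔
      IsFiniteLocallyConstant A ((inverseImage A f).obj ((inverseImage A g).obj F)) :=
  ⟨fun h => h.of_iso ((inverseImageComp A f g _ rfl).app F),
    fun h => h.of_iso ((inverseImageComp A f g _ rfl).app F).symm⟩

lemma IsFiniteLocallyConstant.inverseImage (f : Y ⟶ X) {F : EtaleSheaf A X}
    (h : IsFiniteLocallyConstant A F) :
    IsFiniteLocallyConstant A ((inverseImage A f).obj F) := fun y => by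
  obtain ⟨U, g, hg, ⟨u, hu⟩, M, hM, ⟨i⟩⟩ := h (f y)
  obtain ⟨w, -, hw⟩ := Scheme.Pullback.exists_preimage_pullback u y hu
  refine ⟨pullback g f, pullback.snd g f, inferInstance, ⟨w, hw⟩, M, hM, ⟨?_⟩⟩
  exact ((inverseImageComp A (pullback.snd g f) f _ rfl).app F).symm ≪≫
    (inverseImageComp A (pullback.fst g f) g _ pullback.condition).app F ≪≫
    (EtaleDescent.inverseImage A (pullback.fst g f)).mapIso i ≪≫
    (constantSheafInverseImageIso A (pullback.fst g f)).app M

lemma isFiniteLocallyConstant_of_inverseImage (p : Y ⟶ X) [Etale p] [Surjective p]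
    {F : EtaleSheaf A X} (h : IsFiniteLocallyConstant A ((inverseImage A p).obj F)) :
    IsFiniteLocallyConstant A F := fun x => by
  obtain ⟨y, rfl⟩ := p.surjective x
  obtain ⟨U, f, hf, ⟨u, rfl⟩, M, hM, ⟨i⟩⟩ := h y
  exact ⟨U, f ≫ p, inferInstance, ⟨u, rfl⟩, M, hM,
    ⟨(inverseImageComp A f p _ rfl).app F ≪≫ i⟩⟩

lemma isFiniteLocallyConstant_of_isEmpty [IsEmpty X] (F : EtaleSheaf A X) :
    IsFiniteLocallyConstant A F := fun x => isEmptyElim x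

lemma IsConstructible.of_iso {F F' : EtaleSheaf A X} (e : F ≅ F')
    (h : IsConstructible A F) : IsConstructible A F' := fun U => by
  obtain ⟨n, Z, i, h1, h2, h3, h4, h5⟩ := h U
  exact ⟨n, Z, i, h1, h2, h3, h4, fun j => (h5 j).of_iso ((inverseImage A _).mapIso e)⟩

instance : (constructibleFreeSheaves A X).IsClosedUnderIsomorphisms where
  of_iso e h := ⟨(freeSheaves A X).prop_of_iso e h.1, h.2.of_iso e⟩

end LocallyConstant

/-! ### Maps from reduced schemes into locally closed subschemes -/

section Immersion

/-- The base change of `i` to `T` is a surjective immersion, hence a closed immersion, and a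
surjective closed immersion into a reduced scheme is an isomorphism. -/
lemma IsImmersion.exists_lift {Z W T : Scheme.{u}} (i : Z ⟶ W) [IsImmersion i] [IsReduced T]
    (t : T ⟶ W) (h : Set.range t ⊆ Set.range i) : ∃ l : T ⟶ Z, l ≫ i = t := by
  have : Surjective (pullback.fst t i) := ⟨fun x => by
    obtain ⟨z, hz⟩ := h ⟨x, rfl⟩
    obtain ⟨w, hw, -⟩ := Scheme.Pullback.exists_preimage_pullback x z hz.symm
    exact ⟨w, hw⟩⟩
  have : IsClosedImmersion (pullback.fst t i) := by
    refine .of_isPreimmersion _ ?_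
    rw [(pullback.fst t i).surjective.range_eq]
    exact isClosed_univ
  have := isIso_of_isClosedImmersion_of_surjective (pullback.fst t i)
  exact ⟨inv (pullback.fst t i) ≫ pullback.snd t i, by
    rw [Category.assoc, ← pullback.condition, IsIso.inv_hom_id_assoc]⟩

end Immersion

/-! ### Finite étale schemes over reduced schemes are reduced -/

section Reduced

open TensorProduct in
-- `B` is projective over `R`, so linear forms separate its elements. A nilpotent `b` vanishes in
-- each fibre `κ(p) ⊗ B`, which is reduced, so every linear form sends `b` into all primes of `R`,
-- and hence to `0`.
lemma isReduced_of_finite_etale (R B : Type u) [CommRing R] [CommRing B] [Algebra R B]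
    [Module.Finite R B] [Algebra.Etale R B] [_root_.IsReduced R] : _root_.IsReduced B := by
  have : Module.FinitePresentation R B :=
    Module.FinitePresentation.of_finite_of_finitePresentation R B
  have : Module.Flat R B := inferInstance
  have : Module.Projective R B := Module.Flat.projective_of_finitePresentation
  refine ⟨fun b hb => (Module.forall_dual_apply_eq_zero_iff R b).1 fun φ => ?_⟩
  refine IsNilpotent.eq_zero (nilpotent_iff_mem_prime.2 fun p hp => ?_)
  have : _root_.IsReduced (p.ResidueField ⊗[R] B) :=
    Algebra.FormallyUnramified.isReduced_of_field p.ResidueField _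
  have h0 : (1 : p.ResidueField) ⊗ₜ[R] b = 0 :=
    (hb.map (Algebra.TensorProduct.includeRight (R := R) (A := p.ResidueField) (B := B))).eq_zero
  have h1 := congr_arg (fun t => TensorProduct.rid R _ (φ.lTensor p.ResidueField t)) h0
  rw [← Ideal.algebraMap_residueField_eq_zero (I := p), Algebra.algebraMap_eq_smul_one]
  simpa using h1

lemma isReduced_of_isFinite_of_etale {X Y : Scheme.{u}} (f : Y ⟶ X) [IsFinite f] [Etale f]
    [IsReduced X] : IsReduced Y := by
  have (i : X.affineCover.I₀) : IsReduced ((X.affineCover.pullback₁ f).X i) := by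
    let g : pullback f (X.affineCover.f i) ⟶ X.affineCover.X i := pullback.snd _ _
    have : IsAffine (X.affineCover.X i) := inferInstance
    have : IsFinite g := inferInstance
    have : Etale g := inferInstance
    have : IsAffine (pullback f (X.affineCover.f i)) := isAffine_of_isAffineHom g
    have hf : g.appTop.hom.Finite := g.finite_appTop
    have he : g.appTop.hom.Etale := (HasRingHomProperty.iff_of_isAffine (P := @Etale)).1 ‹Etale g›
    algebraize [g.appTop.hom]
    have := isReduced_of_finite_etale Γ(X.affineCover.X i, ⊤) Γ(pullback f (X.affineCover.f i), ⊤)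
    exact isReduced_of_isAffine_isReduced (X := pullback f (X.affineCover.f i))
  exact @IsReduced.of_openCover _ (X.affineCover.pullback₁ f) this

end Reduced

/-! ### Finite stratifications of an affine scheme -/

section Stratification

open PrimeSpectrum Topology

variable {R : Type u} [CommRing R]

lemma isConstructible_zeroLocus_diff (S : Finset R) (g : R) :
    Topology.IsConstructible (zeroLocus (S : Set R) \ zeroLocus {g}) := by
  refine .sdiff ?_ ?_
  · rw [← isConstructible_compl]
    exact (isRetrocompact_zeroLocus_compl S.finite_toSet).isConstructible
      (isClosed_zeroLocus _).isOpen_compl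
  · rw [← isConstructible_compl]
    exact (isRetrocompact_zeroLocus_compl (Set.finite_singleton _)).isConstructible
      (isClosed_zeroLocus _).isOpen_compl

lemma exists_zeroLocus_diff_subset {C : Set (PrimeSpectrum R)} (hC : Topology.IsConstructible C)
    {w : PrimeSpectrum R} (hw : w ∈ C) :
    ∃ (S : Finset R) (g : R), w ∈ zeroLocus (S : Set R) \ zeroLocus {g} ∧
      zeroLocus (S : Set R) \ zeroLocus {g} ⊆ C := by
  classical
  obtain ⟨D, rfl⟩ := exists_constructibleSetData_iff.2 hC
  obtain ⟨B, hB, hwB⟩ := Set.mem_iUnion₂.1 hw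
  refine ⟨Finset.univ.image B.g, B.f, ?_⟩
  rw [Finset.coe_image, Finset.coe_univ, Set.image_univ]
  exact ⟨hwB, Set.subset_biUnion_of_mem (u := fun C => BasicConstructibleSetData.toSet C) hB⟩

lemma isOpen_constructibleTopology_zeroLocus_diff (S : Finset R) (g : R) :
    IsOpen[constructibleTopology (PrimeSpectrum R)] (zeroLocus (S : Set R) \ zeroLocus {g}) := by
  have h1 : IsCompact (zeroLocus (S : Set R))ᶜ :=
    (isRetrocompact_zeroLocus_compl S.finite_toSet).isCompact
  have h2 : IsCompact (zeroLocus {g} : Set (PrimeSpectrum R))ᶜ :=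
    (isRetrocompact_zeroLocus_compl (Set.finite_singleton _)).isCompact
  exact @IsOpen.inter _ (constructibleTopology (PrimeSpectrum R)) _ _
    (h1.isOpen_constructibleTopology_of_isClosed (isClosed_zeroLocus _))
    (h2.isOpen_constructibleTopology_of_isOpen (isClosed_zeroLocus _).isOpen_compl)

/-- A property of subsets that holds on a constructible neighbourhood of each point and passes to
smaller subsets holds on the strata of a finite stratification. -/
lemma exists_finite_stratification (P : Set (PrimeSpectrum R) → Prop) (h0 : P ∅)
    (hP : ∀ C D, C ⊆ D → P D → P C) (h : ∀ w, ∃ C, Topology.IsConstructible C ∧ w ∈ C ∧ P C) :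
    ∃ (n : ℕ) (S : Fin n → Finset R) (g : Fin n → R),
      (∀ j k, j ≠ k → Disjoint (zeroLocus (S j : Set R) \ zeroLocus {g j})
        (zeroLocus (S k : Set R) \ zeroLocus {g k})) ∧
      (⋃ j, zeroLocus (S j : Set R) \ zeroLocus {g j}) = Set.univ ∧
      ∀ j, P (zeroLocus (S j : Set R) \ zeroLocus {g j}) := by
  classical
  have h' (w : PrimeSpectrum R) : ∃ (S : Finset R) (g : R),
      w ∈ zeroLocus (S : Set R) \ zeroLocus {g} ∧ P (zeroLocus (S : Set R) \ zeroLocus {g}) := by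
    obtain ⟨C, hC, hw, hPC⟩ := h w
    obtain ⟨S, g, h1, h2⟩ := exists_zeroLocus_diff_subset hC hw
    exact ⟨S, g, h1, hP _ _ h2 hPC⟩
  choose S g hw hPS using h'
  -- The spectrum is compact in the constructible topology, where these neighbourhoods are open.
  obtain ⟨t, ht⟩ := (@isCompact_univ (WithConstructibleTopology (PrimeSpectrum R)) _ _).elim_finite_subcover
    (fun w : PrimeSpectrum R => WithTopology.ofTopology ⁻¹' (zeroLocus (S w : Set R) \ zeroLocus {g w}))
    (fun w => WithConstructibleTopology.isOpen_iff.2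
      (isOpen_constructibleTopology_zeroLocus_diff (S w) (g w)))
    (fun w _ => Set.mem_iUnion.2 ⟨w.ofTopology, hw _⟩)
  -- Collect all equations and inequations of the finite cover. The stratum of `a ⊆ E` consists of
  -- the primes that avoid exactly the elements of `a`, so each set of the cover is a union of
  -- strata.
  let E : Finset R := t.biUnion fun w => insert (g w) (S w)
  let Z (a : Finset R) : Set (PrimeSpectrum R) :=
    zeroLocus ((E \ a : Finset R) : Set R) \ zeroLocus {∏ x ∈ a, x}
  have hZ (a : Finset R) (ha : a ⊆ E) (q : PrimeSpectrum R) :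
      q ∈ Z a ↔ ∀ x ∈ E, x ∈ a ↔ x ∉ q.asIdeal := by
    have hpr : (∏ x ∈ a, x) ∈ q.asIdeal ↔ ∃ x ∈ a, x ∈ q.asIdeal :=
      q.isPrime.prod_mem_iff
    simp only [Z, Set.mem_sdiff, mem_zeroLocus, Set.singleton_subset_iff, SetLike.mem_coe, hpr]
    constructor
    · rintro ⟨h1, h2⟩ x hx
      refine ⟨fun hxa hxq => h2 ⟨x, hxa, hxq⟩, fun hxq => ?_⟩
      by_contra hxa
      exact hxq (h1 (Finset.mem_coe.2 (Finset.mem_sdiff.2 ⟨hx, hxa⟩)))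
    · intro H
      refine ⟨fun x hx => ?_, fun ⟨x, hxa, hxq⟩ => (H x (ha hxa)).1 hxa hxq⟩
      obtain ⟨hxE, hxa⟩ := Finset.mem_sdiff.1 (Finset.mem_coe.1 hx)
      by_contra hxq
      exact hxa ((H x hxE).2 hxq)
  let e := (Fintype.equivFin E.powerset).symm
  have he (j) : (e j : Finset R) ⊆ E := Finset.mem_powerset.1 (e j).2
  refine ⟨_, fun j => E \ (e j), fun j => ∏ x ∈ (e j : Finset R), x, fun j k hjk => ?_, ?_, fun j => ?_⟩
  · refine Set.disjoint_left.2 fun q hq hq' => hjk (e.injective (Subtype.ext (Finset.ext fun x => ?_)))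
    have h1 := (hZ _ (he j) q).1 hq
    have h2 := (hZ _ (he k) q).1 hq'
    exact ⟨fun hx => (h2 x (he j hx)).2 ((h1 x (he j hx)).1 hx),
      fun hx => (h1 x (he k hx)).2 ((h2 x (he k hx)).1 hx)⟩
  · refine Set.eq_univ_of_forall fun q => Set.mem_iUnion.2
      ⟨e.symm ⟨E.filter (· ∉ q.asIdeal), Finset.mem_powerset.2 (Finset.filter_subset _ _)⟩, ?_⟩
    beta_reduce
    rw [Equiv.apply_symm_apply]
    exact (hZ _ (Finset.filter_subset _ _) q).2 fun x hx => by simp [hx]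
  · change P (Z (e j))
    obtain hempty | ⟨q, hq⟩ := (Z (e j)).eq_empty_or_nonempty
    · rwa [hempty]
    · obtain ⟨w, hwt, hqw⟩ := Set.mem_iUnion₂.1 (ht (Set.mem_univ (WithTopology.toTopology _ q)))
      refine hP _ _ (fun q' hq' => ?_) (hPS w)
      have h1 := (hZ _ (he j) q).1 hq
      have h2 := (hZ _ (he j) q').1 hq'
      have hE {x : R} (hx : x ∈ insert (g w) (S w)) : x ∈ E := Finset.mem_biUnion.2 ⟨w, hwt, hx⟩
      have key {x : R} (hx : x ∈ insert (g w) (S w)) : x ∈ q.asIdeal ↔ x ∈ q'.asIdeal :=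
        not_iff_not.1 ((h1 x (hE hx)).symm.trans (h2 x (hE hx)))
      refine ⟨fun x hx => (key (Finset.mem_insert_of_mem hx)).1 (hqw.1 hx), fun hg => hqw.2 ?_⟩
      rw [mem_zeroLocus, Set.singleton_subset_iff] at hg ⊢
      exact (key (Finset.mem_insert_self _ _)).2 hg

/-- The sets `V(S) ∩ D(g)` underlie reduced subschemes. -/
lemma exists_isImmersion_range_eq (R : CommRingCat.{u}) (S : Finset R) (g : R) :
    ∃ (Z : Scheme.{u}) (i : Z ⟶ Spec R), IsImmersion i ∧ IsReduced Z ∧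
      Set.range i = zeroLocus (S : Set R) \ zeroLocus {g} := by
  let I : Ideal R := (Ideal.span (S : Set R)).radical
  have : _root_.IsReduced (R ⧸ I) :=
    (Ideal.isRadical_iff_quotient_reduced _).1 (Ideal.radical_isRadical _)
  let c : Spec (.of (R ⧸ I)) ⟶ Spec R := Spec.map (CommRingCat.ofHom (Ideal.Quotient.mk I))
  have : IsClosedImmersion c := IsClosedImmersion.spec_of_surjective _ Ideal.Quotient.mk_surjective
  let V : (Spec (.of (R ⧸ I))).Opens := c ⁻¹ᵁ (basicOpen g)
  have hc : Set.range c = zeroLocus (S : Set R) := by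
    refine (range_comap_of_surjective _ _ Ideal.Quotient.mk_surjective).trans ?_
    rw [Ideal.mk_ker, zeroLocus_radical, zeroLocus_span]
  refine ⟨V, V.ι ≫ c, inferInstance, inferInstance, ?_⟩
  rw [Scheme.Hom.comp_base, TopCat.coe_comp, Set.range_comp, Scheme.Opens.range_ι]
  refine (Set.image_preimage_eq_inter_range (f := c) 
    (t := (basicOpen g : Set (PrimeSpectrum R)))).trans ?_
  rw [hc, basicOpen_eq_zeroLocus_compl]
  exact Set.inter_comm _ _

end Stratification

/-! ### Constructibility as a pointwise condition, and its pullback -/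

section Constructible

variable {A : Type u} [CommRing A] {W X Y : Scheme.{u}}

/-- The sheaf `F` becomes locally constant of finite type on every reduced scheme over `X` via a
subset `C` of `W`. -/
def IsConstantOn (F : EtaleSheaf A X) (t₀ : W ⟶ X) (C : Set W) : Prop :=
  ∀ (T : Scheme.{u}) [IsReduced T] (t : T ⟶ W), Set.range t ⊆ C →
    IsFiniteLocallyConstant A ((inverseImage A (t ≫ t₀)).obj F)

lemma IsConstantOn.mono {F : EtaleSheaf A X} {t₀ : W ⟶ X} {C D : Set W} (hCD : C ⊆ D)
    (h : IsConstantOn F t₀ D) : IsConstantOn F t₀ C := fun T _ t ht => h T t (ht.trans hCD)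

lemma isConstantOn_empty (F : EtaleSheaf A X) (t₀ : W ⟶ X) : IsConstantOn F t₀ ∅ :=
  fun T _ t ht => by
    have : IsEmpty T := Set.range_eq_empty_iff.1 (Set.subset_empty_iff.1 ht)
    exact isFiniteLocallyConstant_of_isEmpty _

lemma isConstantOn_range {Z : Scheme.{u}} (i : Z ⟶ W) [IsImmersion i] {F : EtaleSheaf A X}
    {t₀ : W ⟶ X} (h : IsFiniteLocallyConstant A ((inverseImage A (i ≫ t₀)).obj F)) :
    IsConstantOn F t₀ (Set.range i) := fun T _ t ht => by
  obtain ⟨l, rfl⟩ := IsImmersion.exists_lift i t ht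
  rw [Category.assoc, isFiniteLocallyConstant_comp_iff]
  exact h.inverseImage l

/-- `F` is, around each point of `W`, constant on a constructible set. -/
def IsStratified (F : EtaleSheaf A X) (t₀ : W ⟶ X) : Prop :=
  ∀ w : W, ∃ C : Set W, Topology.IsConstructible C ∧ w ∈ C ∧ IsConstantOn F t₀ C

lemma IsConstructible.isStratified {F : EtaleSheaf A X} (h : IsConstructible A F)
    (U : X.affineOpens) : IsStratified F (U : X.Opens).ι := fun w => by
  obtain ⟨n, Z, i, h1, h2, -, h4, h5⟩ := h U
  obtain ⟨j, hj⟩ := Set.mem_iUnion.1 (h4.ge (Set.mem_univ w))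
  have := h1 j
  exact ⟨_, h2 j, hj, isConstantOn_range (i j) (h5 j)⟩

lemma IsStratified.exists_decomposition [IsAffine W] {F : EtaleSheaf A X} {t₀ : W ⟶ X}
    (h : IsStratified F t₀) : ∃ (n : ℕ) (Z : Fin n → Scheme.{u}) (i : ∀ j, Z j ⟶ W),
    (∀ j, IsImmersion (i j)) ∧
    (∀ j, Topology.IsConstructible (Set.range (i j))) ∧
    (∀ j k, j ≠ k → Disjoint (Set.range (i j)) (Set.range (i k))) ∧
    (⋃ j, Set.range (i j)) = Set.univ ∧
    ∀ j, IsFiniteLocallyConstant A ((inverseImage A (i j ≫ t₀)).obj F) := by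
  let e : W ≅ Spec Γ(W, ⊤) := W.isoSpec
  have he (x : W) : e.inv (e.hom x) = x := by simp
  have he' (x : Spec Γ(W, ⊤)) : e.hom (e.inv x) = x := by simp
  obtain ⟨n, S, g, h1, h2, h3⟩ := exists_finite_stratification (R := Γ(W, ⊤))
    (fun C => IsConstantOn F t₀ (e.hom ⁻¹' C)) (isConstantOn_empty F t₀)
    (fun C D hCD hD => hD.mono (Set.preimage_mono hCD)) fun w => by
      obtain ⟨C, hC, hw, hF⟩ := h (e.inv w)
      refine ⟨e.inv ⁻¹' C, e.inv.isConstructible_preimage hC, hw, hF.mono fun x hx => ?_⟩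
      have hx' : e.inv (e.hom x) ∈ C := hx
      rwa [he] at hx'
  choose Z i hi hZ hr using fun j => exists_isImmersion_range_eq Γ(W, ⊤) (S j) (g j)
  have hr' (j) : Set.range (i j ≫ e.inv) = e.hom ⁻¹' Set.range (i j) := by
    ext x
    constructor
    · rintro ⟨z, rfl⟩
      exact ⟨z, (he' _).symm⟩
    · rintro ⟨z, hz⟩
      exact ⟨z, (congr_arg e.inv hz).trans (he x)⟩
  refine ⟨n, Z, fun j => i j ≫ e.inv, fun j => inferInstance, fun j => ?_, fun j k hjk => ?_, ?_,
    fun j => ?_⟩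
  · rw [hr', hr]
    exact e.hom.isConstructible_preimage (isConstructible_zeroLocus_diff _ _)
  · rw [hr', hr', hr, hr]
    exact (h1 j k hjk).preimage _
  · refine Set.eq_univ_of_forall fun x => ?_
    obtain ⟨j, hj⟩ := Set.mem_iUnion.1 (h2.ge (Set.mem_univ (e.hom x)))
    rw [← hr j] at hj
    exact Set.mem_iUnion.2 ⟨j, (hr' j).ge hj⟩
  · refine h3 j (Z j) (i j ≫ e.inv) ?_
    rw [hr', hr]

/-- The pointwise form asks neither for disjointness nor for finiteness, which makes pullback and
descent local questions. -/
lemma isConstructible_iff_isStratified {F : EtaleSheaf A X} :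
    IsConstructible A F ↔ ∀ U : X.affineOpens, IsStratified F (U : X.Opens).ι :=
  ⟨fun h U => h.isStratified U, fun h U => (h U).exists_decomposition⟩

lemma IsConstantOn.inverseImage {F : EtaleSheaf A X} {f : Y ⟶ X} {V : Scheme.{u}} {t₀ : W ⟶ X}
    {C : Set W} (h : IsConstantOn F t₀ C) (v : V ⟶ Y) (g : V ⟶ W) (w : g ≫ t₀ = v ≫ f) :
    IsConstantOn ((inverseImage A f).obj F) v (g ⁻¹' C) := fun T _ t ht => by
  rw [← isFiniteLocallyConstant_comp_iff, Category.assoc, ← w, ← Category.assoc]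
  refine h T (t ≫ g) ?_
  rintro _ ⟨x, rfl⟩
  exact ht ⟨x, rfl⟩

lemma IsConstructible.inverseImage (f : Y ⟶ X) {F : EtaleSheaf A X} (h : IsConstructible A F) :
    IsConstructible A ((inverseImage A f).obj F) := by
  refine isConstructible_iff_isStratified.2 fun V v => ?_
  obtain ⟨_, ⟨U, hU, rfl⟩, hfv, -⟩ :=
    X.isBasis_affineOpens.exists_subset_of_mem_open (Set.mem_univ (f v.1)) isOpen_univ
  obtain ⟨_, ⟨V', hV', rfl⟩, hv, hVV'⟩ := Y.isBasis_affineOpens.exists_subset_of_mem_open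
    (u := (V : Y.Opens) ⊓ f ⁻¹ᵁ U) ⟨v.2, hfv⟩
    ((V : Y.Opens) ⊓ f ⁻¹ᵁ U).isOpen
  have hV : V' ≤ V := fun x hx => (hVV' hx).1
  let g : (V' : Scheme) ⟶ U := f.resLE U V' fun x hx => (hVV' hx).2
  let k : (V' : Scheme) ⟶ V.1 := Y.homOfLE hV
  obtain ⟨C, hC, hxC, hF⟩ := h.isStratified ⟨U, hU⟩ (g ⟨v.1, hv⟩)
  have hFC : IsConstantOn ((EtaleDescent.inverseImage A f).obj F) (Scheme.Opens.ι V') (g ⁻¹' C) :=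
    hF.inverseImage (Scheme.Opens.ι V') g (Scheme.Hom.resLE_comp_ι _ _)
  have : IsAffine (V' : Scheme) := hV'
  have : IsAffine (V : Y.Opens) := V.2
  -- The constructible set is found on a smaller affine `V'`. Its image in `V` stays constructible
  -- because the inclusion is quasi-compact, and maps into that image factor through `V'`.
  refine ⟨k '' (g ⁻¹' C), ?_, ⟨_, hxC, Subtype.ext (by simp [k])⟩, fun T _ t ht => ?_⟩
  · have : QuasiCompact k := inferInstance
    exact k.isConstructible_image (g.isConstructible_preimage hC)
  · have hr : Set.range t ⊆ Set.range k := ht.trans (Set.image_subset_range _ _)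
    let l := IsOpenImmersion.lift k t hr
    have hl : l ≫ k = t := IsOpenImmersion.lift_fac _ _ _
    rw [← hl, Category.assoc, show k ≫ V.1.ι = Scheme.Opens.ι V' from Scheme.homOfLE_ι _ _]
    refine hFC T l ?_
    rintro _ ⟨x, rfl⟩
    obtain ⟨y, hy, hyx⟩ := ht ⟨x, rfl⟩
    rw [← hl] at hyx
    have : y = l x := k.isOpenEmbedding.injective hyx
    exact this ▸ hy

end Constructible

/-! ### Descent of constructibility along a finite étale surjection -/

section ConstructibleDescent

variable {A : Type u} [CommRing A] {W V X Y : Scheme.{u}}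

/-- Over a point of this set the fibre of `p` meets `V₀`, and only inside `C`. Hence the part of `T
×_W V` over `V₀` is reduced, étale and surjective over `T`, and maps into `C`; local constancy there
descends to `T`. -/
lemma isConstantOn_of_inverseImage {π : Y ⟶ X} {F : EtaleSheaf A X} {v : V ⟶ Y} {t₀ : W ⟶ X}
    {C : Set V} (h : IsConstantOn ((inverseImage A π).obj F) v C) (p : V ⟶ W) [IsFinite p]
    [Etale p] (w : p ≫ t₀ = v ≫ π) (V₀ : V.Opens) :
    IsConstantOn F t₀ (p '' V₀ \ p '' (V₀ \ C)) := fun T _ t ht => by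
  have : IsReduced (pullback t p) := isReduced_of_isFinite_of_etale (pullback.fst t p)
  let V₁ : (pullback t p).Opens := pullback.snd t p ⁻¹ᵁ V₀
  let q : (V₁ : Scheme) ⟶ T := V₁.ι ≫ pullback.fst t p
  let r : (V₁ : Scheme) ⟶ V := V₁.ι ≫ pullback.snd t p
  have hqr : q ≫ t = r ≫ p := by simp only [q, r, Category.assoc, pullback.condition]
  have : Surjective q := ⟨fun z => by
    obtain ⟨v, hv, hvz⟩ := (ht ⟨z, rfl⟩).1
    obtain ⟨a, ha, hav⟩ := Scheme.Pullback.exists_preimage_pullback z v hvz.symm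
    have ha' : a ∈ V₁ := by
      change pullback.snd t p a ∈ V₀
      rwa [hav]
    exact ⟨⟨a, ha'⟩, ha⟩⟩
  refine isFiniteLocallyConstant_of_inverseImage q ?_
  rw [← isFiniteLocallyConstant_comp_iff, ← Category.assoc, hqr, Category.assoc, w,
    ← Category.assoc, isFiniteLocallyConstant_comp_iff]
  refine h V₁ r ?_
  rintro _ ⟨a, rfl⟩
  by_contra hC
  have hqa : t (q a) = p (r a) := congr_arg (fun k : (V₁ : Scheme) ⟶ W => k a) hqr
  exact (ht ⟨q a, rfl⟩).2 ⟨r a, ⟨a.2, hC⟩, hqa.symm⟩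

lemma isConstructible_of_inverseImage (π : Y ⟶ X) [IsFinite π] [Etale π] [Surjective π]
    {F : EtaleSheaf A X} (h : IsConstructible A ((inverseImage A π).obj F)) :
    IsConstructible A F := by
  refine isConstructible_iff_isStratified.2 fun U x => ?_
  let p : (π ⁻¹ᵁ (U : X.Opens) : Scheme) ⟶ (U : X.Opens) := π ∣_ U
  have : Surjective p :=
    MorphismProperty.of_isPullback (isPullback_morphismRestrict π U).flip ‹Surjective π›
  have : IsFinite p := inferInstance
  have : Etale p := inferInstance
  have hU : IsAffineOpen (U : X.Opens) := U.2
  have : IsAffine (U : X.Opens) := hU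
  obtain ⟨y, hy⟩ := p.surjective x
  obtain ⟨C, hC, hyC, hF⟩ := h.isStratified ⟨π ⁻¹ᵁ (U : X.Opens), hU.preimage π⟩ y
  -- The fibre over `x` is discrete, so an open set isolates `y` in it. Shrinking to `V₀` inside it
  -- ensures that `V₀ \ C` has no point over `x`.
  obtain ⟨O, hO, hOy⟩ : ∃ O : Set (π ⁻¹ᵁ (U : X.Opens) : Scheme), IsOpen O ∧
      O ∩ p ⁻¹' {x} = {y} :=
    isDiscrete_iff_forall_mem_exists_isOpen.1 (p.isDiscrete_preimage_singleton x) y hy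
  have hyO : y ∈ O := (hOy.ge rfl).1
  obtain ⟨_, ⟨V₀, hV₀, rfl⟩, hyV, hVO⟩ :=
    (Scheme.isBasis_affineOpens _).exists_subset_of_mem_open hyO hO
  have hc : Topology.IsConstructible (V₀ : Set (π ⁻¹ᵁ (U : X.Opens) : Scheme)) := by
    have : IsAffine (π ⁻¹ᵁ (U : X.Opens) : Scheme) := hU.preimage π
    exact hV₀.isCompact.isConstructible V₀.isOpen
  refine ⟨p '' V₀ \ p '' (V₀ \ C), .sdiff (p.isConstructible_image hc)
    (p.isConstructible_image (hc.sdiff hC)), ⟨⟨y, hyV, hy⟩, ?_⟩,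
    isConstantOn_of_inverseImage hF p (morphismRestrict_ι _ _) V₀⟩
  rintro ⟨y', ⟨hyV', hyC'⟩, hxy'⟩
  have : y' ∈ O ∩ p ⁻¹' {x} := ⟨hVO hyV', hxy'⟩
  rw [hOy] at this
  exact hyC' (this ▸ hyC)

end ConstructibleDescent

end EtaleDescent

end

theorem mainTheorem11
    (ℓ : ℕ) [Fact ℓ.Prime] (E : Type u) [Field E] [Algebra ℚ_[ℓ] E] [FiniteDimensional ℚ_[ℓ] E]
    (𝔪 : Ideal (ringOfIntegers ℓ E)) [𝔪.IsMaximal] (n : ℕ) (hn : 1 ≤ n)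
    {X Y : Scheme.{u}} (hℓX : IsUnit (ℓ : Γ(X, ⊤)))
    (π : Y ⟶ X) (G : Type u) [Group G] [Finite G] (ρ : G →* Aut (Over.mk π))
    (hπ : IsGaloisCover π ρ) :
    (∃ h : ∀ 𝒢, freeSheaves (ringOfIntegers ℓ E ⧸ 𝔪 ^ n) X 𝒢 →
          freeSheaves (ringOfIntegers ℓ E ⧸ 𝔪 ^ n) Y ((inverseImage _ π).obj 𝒢),
        (EquivariantSheaf.restrictedOfBase ρ _ _ h).IsEquivalence) ∧
    (∃ h : ∀ 𝒢, constructibleFreeSheaves (ringOfIntegers ℓ E ⧸ 𝔪 ^ n) X 𝒢 →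
          constructibleFreeSheaves (ringOfIntegers ℓ E ⧸ 𝔪 ^ n) Y ((inverseImage _ π).obj 𝒢),
        (EquivariantSheaf.restrictedOfBase ρ _ _ h).IsEquivalence) := by
  have := hπ.finite
  have := hπ.etale
  have := hπ.surjective
  exact ⟨⟨fun 𝒢 h => freeSheaves_inverseImage π h,
      EquivariantSheaf.restrictedOfBase_isEquivalence hπ _
        fun 𝒢 h => freeSheaves_of_inverseImage π h⟩,
    ⟨fun 𝒢 h => ⟨freeSheaves_inverseImage π h.1, h.2.inverseImage π⟩,
      EquivariantSheaf.restrictedOfBase_isEquivalence hπ _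
        fun 𝒢 h => ⟨freeSheaves_of_inverseImage π h.1, isConstructible_of_inverseImage π h.2⟩⟩⟩
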